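/- Fix a countably infinite set of variables and a signature $\Sigma$ with countably many function symbols and countably many predicate symbols of each arity $n\ge 0$. Terms are built from variables and function symbols as usual. Formulas are built from $\bot$, atoms $P(t_1,\dots,t_n)$ and equations $t_1=t_2$ with $\neg,\wedge,\vee,\to,\forall x,\exists x$; they are identified up to renaming of bound variables. $\mathrm{free}(\cdot)$ denotes the set of free variables, and $[x:=t]A$ denotes capture-avoiding substitution. *Proof system.* A sequent $\Gamma\vdash A$ consists of a finite set $\Gamma$ of formulas and a formula $A$; $\Gamma,A$ means $\Gamma\cup\{A\}$. The inference rules are: - without premises: $\Gamma,A\vdash A$; $\;\Gamma\vdash\neg\bot$; $\;\Gamma\vdash A\vee\neg A$; $\;\Gamma\vdash t=t$; - from $\Gamma\vdash\bot$ infer $\Gamma\vdash A$; - from $\Gamma\vdash A_1$ and $\Gamma\vdash A_2$ infer $\Gamma\vdash A_1\wedge A_2$; from $\Gamma\vdash A_1\wedge A_2$ infer $\Gamma\vdash A_i$ ($i=1,2$); - from $\Gamma\vdash A_i$ infer $\Gamma\vdash A_1\vee A_2$ ($i=1,2$); from $\Gamma\vdash A_1\vee A_2$, $\Gamma,A_1\vdash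 A_3$ and $\Gamma,A_2\vdash A_3$ infer $\Gamma\vdash A_3$; - from $\Gamma,A_1\vdash A_2$ infer $\Gamma\vdash A_1\to A_2$; from $\Gamma\vdash A_1\to A_2$ and $\Gamma\vdash A_1$ infer $\Gamma\vdash A_2$; - from $\Gamma\vdash A$ infer $\Gamma\vdash\forall x\,A$, if $x\notin\mathrm{free}(\Gamma)$; from $\Gamma\vdash\forall x\,A$ infer $\Gamma\vdash[x:=t]A$; - from $\Gamma\vdash[x:=t]A$ infer $\Gamma\vdash\exists x\,A$; from $\Gamma\vdash\exists x\,A_1$ and $\Gamma,A_1\vdash A_2$ infer $\Gamma\vdash A_2$, if $x\notin\mathrm{free}(\Gamma\cup\{A_2\})$; - from $\Gamma\vdash t_1=t_2$ and $\Gamma\vdash[x:=t_1]A$ infer $\Gamma\vdash[x:=t_2]A$; - in both directions, between $\Gamma\vdash B$ and $\Gamma\vdash B'$ for the pairs $(B,B')$: $(\neg\neg A,\;A)$, $(\neg(A_1\wedge A_2),\;\neg A_1\vee\neg A_2)$, $(\neg(A_1\vee A_2),\;\neg A_1\wedge\neg A_2)$, $(\neg(A_1\to A_2),\;A_1\wedge\neg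 A_2)$, $(\neg\forall x\,A,\;\exists x\,\neg A)$, $(\neg\exists x\,A,\;\forall x\,\neg A)$. A sequent is provable if it is the last entry of a finite sequence of sequents each of which is the conclusion of an instance of a rule whose premises occur earlier in the sequence. *Semantics.* The truth values are $\mathsf t$ (true), $\mathsf f$ (false) and $\mathsf b$ (both). A structure consists of a non-empty domain $U$, a function $U^n\to U$ for each $n$-ary function symbol, a function $U^n\to\{\mathsf t,\mathsf f,\mathsf b\}$ for each $n$-ary predicate symbol, and a function $\mathrm{eq}:U\times U\to\{\mathsf t,\mathsf f,\mathsf b\}$ such that $\mathrm{eq}(d,d)\in\{\mathsf t,\mathsf b\}$ for all $d$ and $\mathrm{eq}(d,d')=\mathsf f$ for all $d\ne d'$. Given an assignment of elements of $U$ to the variables, terms and atoms are evaluated as usual, equations by $\mathrm{eq}$, and $\bot$ has value $\mathsf f$. Order the values by $\mathsf f<\mathsf b<\mathsf t$. Then $\neg$ exchanges $\mathsf t$ and $\mathsf f$ and fixes $\mathsf b$; $\wedge$ and $\vee$ are minimum and maximum; $A_1\to A_2$ has value $\mathsf t$ if $A_1$ has value $\mathsf f$, and the value of $A_2$ otherwise;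 $\forall x\,A$ and $\exists x\,A$ have as value the minimum and the maximum of the values of $A$ as the value of $x$ ranges over $U$. We write $\Gamma\models A$ if, for every structure and every assignment, some formula in $\Gamma$ has value $\mathsf f$ or $A$ has value $\mathsf t$ or $\mathsf b$. **Theorem.** For every finite set $\Gamma$ of formulas and every formula $A$, the sequent $\Gamma\vdash A$ is provable if and only if $\Gamma\models A$. -/

import Mathlib

universe u v w

namespace LPif

/-! ### Language

A signature is a first-order language `L` (function and predicate symbols of each arity); the
variable symbols are the natural numbers, and the terms over the signature are `L.Term ℕ`.

Formulas are taken up to renaming of bound variables.  They are represented in the locally nameless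
style of Mathlib's `BoundedFormula`: in a term of type `L.Term (ℕ ⊕ Fin n)`, `Sum.inl x` is the
variable symbol `x` (a free occurrence), and `Sum.inr i` refers to the `i`-th enclosing quantifier,
counted from the outside. -/

/-- Formulas in the scope of `n` further quantifiers. -/
inductive PreFormula (L : FirstOrder.Language.{u, v}) : ℕ → Type (max u v)
  | falsum {n : ℕ} : PreFormula L n
  | pred {n k : ℕ} (P : L.Relations k) (ts : Fin k → L.Term (ℕ ⊕ Fin n)) : PreFormula L n
  | equal {n : ℕ} (t₁ t₂ : L.Term (ℕ ⊕ Fin n)) : PreFormula L n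
  | neg {n : ℕ} (A : PreFormula L n) : PreFormula L n
  | conj {n : ℕ} (A₁ A₂ : PreFormula L n) : PreFormula L n
  | disj {n : ℕ} (A₁ A₂ : PreFormula L n) : PreFormula L n
  | impl {n : ℕ} (A₁ A₂ : PreFormula L n) : PreFormula L n
  | all {n : ℕ} (A : PreFormula L (n + 1)) : PreFormula L n
  | ex {n : ℕ} (A : PreFormula L (n + 1)) : PreFormula L n

/-- The formulas over the signature `L`, up to renaming of bound variables. -/
abbrev Formula (L : FirstOrder.Language.{u, v}) := PreFormula L 0

noncomputable instance (L : FirstOrder.Language.{u, v}) : DecidableEq (Formula L) := Classical.decEq _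

namespace PreFormula

variable {L : FirstOrder.Language.{u, v}}

/-- Replace the variable symbol `x` by a reference to a new outermost quantifier. -/
def closeVar (x : ℕ) {n : ℕ} : ℕ ⊕ Fin n → ℕ ⊕ Fin (n + 1)
  | Sum.inl y => if y = x then Sum.inr 0 else Sum.inl y
  | Sum.inr i => Sum.inr i.succ

/-- Bind the free occurrences of `x` by a new outermost quantifier (not yet written). -/
def close (x : ℕ) : {n : ℕ} → PreFormula L n → PreFormula L (n + 1)
  | _, falsum => falsum
  | _, pred P ts => pred P fun i => (ts i).relabel (closeVar x)
  | _, equal t₁ t₂ => equal (t₁.relabel (closeVar x)) (t₂.relabel (closeVar x))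
  | _, neg A => neg (close x A)
  | _, conj A₁ A₂ => conj (close x A₁) (close x A₂)
  | _, disj A₁ A₂ => disj (close x A₁) (close x A₂)
  | _, impl A₁ A₂ => impl (close x A₁) (close x A₂)
  | _, all A => all (close x A)
  | _, ex A => ex (close x A)

/-- What the substitution of `t` for `x` puts in place of a variable. -/
def substVar (x : ℕ) (t : L.Term ℕ) {n : ℕ} : ℕ ⊕ Fin n → L.Term (ℕ ⊕ Fin n)
  | Sum.inl y => if y = x then t.relabel Sum.inl else FirstOrder.Language.Term.var (Sum.inl y)
  | Sum.inr i => FirstOrder.Language.Term.var (Sum.inr i)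

/-- `subst x t A` is `[x := t] A`; no variable of `t` can be captured, since bound variables are
nameless. -/
def subst (x : ℕ) (t : L.Term ℕ) : {n : ℕ} → PreFormula L n → PreFormula L n
  | _, falsum => falsum
  | _, pred P ts => pred P fun i => (ts i).subst (substVar x t)
  | _, equal t₁ t₂ => equal (t₁.subst (substVar x t)) (t₂.subst (substVar x t))
  | _, neg A => neg (subst x t A)
  | _, conj A₁ A₂ => conj (subst x t A₁) (subst x t A₂)
  | _, disj A₁ A₂ => disj (subst x t A₁) (subst x t A₂)
  | _, impl A₁ A₂ => impl (subst x t A₁) (subst x t A₂)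
  | _, all A => all (subst x t A)
  | _, ex A => ex (subst x t A)

/-- The free variables of a formula. -/
def free : {n : ℕ} → PreFormula L n → Set ℕ
  | _, falsum => ∅
  | _, pred _ ts => {x | ∃ i, x ∈ (ts i).varFinsetLeft}
  | _, equal t₁ t₂ => {x | x ∈ t₁.varFinsetLeft ∨ x ∈ t₂.varFinsetLeft}
  | _, neg A => free A
  | _, conj A₁ A₂ => free A₁ ∪ free A₂
  | _, disj A₁ A₂ => free A₁ ∪ free A₂
  | _, impl A₁ A₂ => free A₁ ∪ free A₂
  | _, all A => free A
  | _, ex A => free A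

end PreFormula

namespace Formula

variable {L : FirstOrder.Language.{u, v}}

/-- The formula `t₁ = t₂`. -/
def eq (t₁ t₂ : L.Term ℕ) : Formula L :=
  PreFormula.equal (t₁.relabel Sum.inl) (t₂.relabel Sum.inl)

/-- The formula `∀ x, A`. -/
def forall_ (x : ℕ) (A : Formula L) : Formula L := PreFormula.all (A.close x)

/-- The formula `∃ x, A`. -/
def exists_ (x : ℕ) (A : Formula L) : Formula L := PreFormula.ex (A.close x)

end Formula

/-! ### Proof system -/

/-- A sequent `Γ ⊢ A`. -/
structure Sequent (L : FirstOrder.Language.{u, v}) where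
  left : Finset (Formula L)
  right : Formula L

section ProofSystem

variable {L : FirstOrder.Language.{u, v}}

/-- The free variables of a finite set of formulas. -/
def freeVars (Γ : Finset (Formula L)) : Set ℕ := ⋃ A ∈ Γ, PreFormula.free A

local infix:45 " ⊢ₛ " => Sequent.mk

open PreFormula Formula in
/-- `Rule ps s`: the sequent `s` is the conclusion, and `ps` is the list of premises, of an instance
of an inference rule.  Each two-way rule is given by its two directions. -/
inductive Rule : List (Sequent L) → Sequent L → Prop
  | ident (Γ : Finset (Formula L)) (A : Formula L) :
      Rule [] (insert A Γ ⊢ₛ A)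
  | trueI (Γ : Finset (Formula L)) :
      Rule [] (Γ ⊢ₛ neg falsum)
  | em (Γ : Finset (Formula L)) (A : Formula L) :
      Rule [] (Γ ⊢ₛ disj A (neg A))
  | falseE (Γ : Finset (Formula L)) (A : Formula L) :
      Rule [Γ ⊢ₛ falsum] (Γ ⊢ₛ A)
  | conjI (Γ : Finset (Formula L)) (A₁ A₂ : Formula L) :
      Rule [Γ ⊢ₛ A₁, Γ ⊢ₛ A₂] (Γ ⊢ₛ conj A₁ A₂)
  | conjE₁ (Γ : Finset (Formula L)) (A₁ A₂ : Formula L) :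
      Rule [Γ ⊢ₛ conj A₁ A₂] (Γ ⊢ₛ A₁)
  | conjE₂ (Γ : Finset (Formula L)) (A₁ A₂ : Formula L) :
      Rule [Γ ⊢ₛ conj A₁ A₂] (Γ ⊢ₛ A₂)
  | disjI₁ (Γ : Finset (Formula L)) (A₁ A₂ : Formula L) :
      Rule [Γ ⊢ₛ A₁] (Γ ⊢ₛ disj A₁ A₂)
  | disjI₂ (Γ : Finset (Formula L)) (A₁ A₂ : Formula L) :
      Rule [Γ ⊢ₛ A₂] (Γ ⊢ₛ disj A₁ A₂)
  | disjE (Γ : Finset (Formula L)) (A₁ A₂ A₃ : Formula L) :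
      Rule [Γ ⊢ₛ disj A₁ A₂, insert A₁ Γ ⊢ₛ A₃, insert A₂ Γ ⊢ₛ A₃] (Γ ⊢ₛ A₃)
  | implI (Γ : Finset (Formula L)) (A₁ A₂ : Formula L) :
      Rule [insert A₁ Γ ⊢ₛ A₂] (Γ ⊢ₛ impl A₁ A₂)
  | implE (Γ : Finset (Formula L)) (A₁ A₂ : Formula L) :
      Rule [Γ ⊢ₛ impl A₁ A₂, Γ ⊢ₛ A₁] (Γ ⊢ₛ A₂)
  | forallI (Γ : Finset (Formula L)) (x : ℕ) (A : Formula L) (hx : x ∉ freeVars Γ) :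
      Rule [Γ ⊢ₛ A] (Γ ⊢ₛ forall_ x A)
  | forallE (Γ : Finset (Formula L)) (x : ℕ) (t : L.Term ℕ) (A : Formula L) :
      Rule [Γ ⊢ₛ forall_ x A] (Γ ⊢ₛ subst x t A)
  | existsI (Γ : Finset (Formula L)) (x : ℕ) (t : L.Term ℕ) (A : Formula L) :
      Rule [Γ ⊢ₛ subst x t A] (Γ ⊢ₛ exists_ x A)
  | existsE (Γ : Finset (Formula L)) (x : ℕ) (A₁ A₂ : Formula L)
      (hx : x ∉ freeVars (Γ ∪ {A₂})) :
      Rule [Γ ⊢ₛ exists_ x A₁, insert A₁ Γ ⊢ₛ A₂] (Γ ⊢ₛ A₂)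
  | eqI (Γ : Finset (Formula L)) (t : L.Term ℕ) :
      Rule [] (Γ ⊢ₛ Formula.eq t t)
  | eqE (Γ : Finset (Formula L)) (x : ℕ) (t₁ t₂ : L.Term ℕ) (A : Formula L) :
      Rule [Γ ⊢ₛ Formula.eq t₁ t₂, Γ ⊢ₛ subst x t₁ A] (Γ ⊢ₛ subst x t₂ A)
  | negM (Γ : Finset (Formula L)) (A : Formula L) :
      Rule [Γ ⊢ₛ neg (neg A)] (Γ ⊢ₛ A)
  | negM' (Γ : Finset (Formula L)) (A : Formula L) :
      Rule [Γ ⊢ₛ A] (Γ ⊢ₛ neg (neg A))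
  | conjM (Γ : Finset (Formula L)) (A₁ A₂ : Formula L) :
      Rule [Γ ⊢ₛ neg (conj A₁ A₂)] (Γ ⊢ₛ disj (neg A₁) (neg A₂))
  | conjM' (Γ : Finset (Formula L)) (A₁ A₂ : Formula L) :
      Rule [Γ ⊢ₛ disj (neg A₁) (neg A₂)] (Γ ⊢ₛ neg (conj A₁ A₂))
  | disjM (Γ : Finset (Formula L)) (A₁ A₂ : Formula L) :
      Rule [Γ ⊢ₛ neg (disj A₁ A₂)] (Γ ⊢ₛ conj (neg A₁) (neg A₂))
  | disjM' (Γ : Finset (Formula L)) (A₁ A₂ : Formula L) :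
      Rule [Γ ⊢ₛ conj (neg A₁) (neg A₂)] (Γ ⊢ₛ neg (disj A₁ A₂))
  | implM (Γ : Finset (Formula L)) (A₁ A₂ : Formula L) :
      Rule [Γ ⊢ₛ neg (impl A₁ A₂)] (Γ ⊢ₛ conj A₁ (neg A₂))
  | implM' (Γ : Finset (Formula L)) (A₁ A₂ : Formula L) :
      Rule [Γ ⊢ₛ conj A₁ (neg A₂)] (Γ ⊢ₛ neg (impl A₁ A₂))
  | forallM (Γ : Finset (Formula L)) (x : ℕ) (A : Formula L) :
      Rule [Γ ⊢ₛ neg (forall_ x A)] (Γ ⊢ₛ exists_ x (neg A))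
  | forallM' (Γ : Finset (Formula L)) (x : ℕ) (A : Formula L) :
      Rule [Γ ⊢ₛ exists_ x (neg A)] (Γ ⊢ₛ neg (forall_ x A))
  | existsM (Γ : Finset (Formula L)) (x : ℕ) (A : Formula L) :
      Rule [Γ ⊢ₛ neg (exists_ x A)] (Γ ⊢ₛ forall_ x (neg A))
  | existsM' (Γ : Finset (Formula L)) (x : ℕ) (A : Formula L) :
      Rule [Γ ⊢ₛ forall_ x (neg A)] (Γ ⊢ₛ neg (exists_ x A))

/-- `l` is a derivation of `s` from the set of sequents `H`: its last entry is `s`, and each entry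
is in `H` or is the conclusion of a rule instance whose premises occur earlier in `l`. -/
def IsDerivation (H : Set (Sequent L)) (l : List (Sequent L)) (s : Sequent L) : Prop :=
  l.getLast? = some s ∧
    ∀ i : Fin l.length, l.get i ∈ H ∨
      ∃ ps, Rule ps (l.get i) ∧ ∀ p ∈ ps, ∃ j : Fin l.length, j < i ∧ l.get j = p

/-- A sequent is provable if it has a derivation from the empty set of sequents. -/
def Provable (Γ : Finset (Formula L)) (A : Formula L) : Prop :=
  ∃ l, IsDerivation ∅ l (Γ ⊢ₛ A)

end ProofSystem

/-! ### Interpretation -/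

/-- The truth values: true, false, both true and false. -/
inductive TruthValue
  | tt | ff | both

namespace TruthValue

open Classical in
/-- The value of a negation. -/
noncomputable def neg (a : TruthValue) : TruthValue :=
  if a = ff then tt else if a = tt then ff else both

open Classical in
/-- The value of a conjunction. -/
noncomputable def conj (a b : TruthValue) : TruthValue :=
  if a = tt ∧ b = tt then tt else if a = ff ∨ b = ff then ff else both

open Classical in
/-- The value of a disjunction. -/
noncomputable def disj (a b : TruthValue) : TruthValue :=
  if a = tt ∨ b = tt then tt else if a = ff ∧ b = ff then ff else both

open Classical in
/-- The value of an implication. -/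
noncomputable def impl (a b : TruthValue) : TruthValue :=
  if a = ff ∨ b = tt then tt else if a ≠ ff ∧ b = ff then ff else both

open Classical in
/-- The value of a universal quantification, `a d` being the value of its body at `d`. -/
noncomputable def all {U : Type w} (a : U → TruthValue) : TruthValue :=
  if ∀ d, a d = tt then tt else if ∃ d, a d = ff then ff else both

open Classical in
/-- The value of an existential quantification, `a d` being the value of its body at `d`. -/
noncomputable def ex {U : Type w} (a : U → TruthValue) : TruthValue :=
  if ∃ d, a d = tt then tt else if ∀ d, a d = ff then ff else both

end TruthValue

/-- Three-valued structures over the signature `L`.  Equality is not false exactly for identical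
arguments. -/
structure Struc (L : FirstOrder.Language.{u, v}) where
  U : Type w
  nonempty : Nonempty U
  func {n : ℕ} : L.Functions n → (Fin n → U) → U
  pred {n : ℕ} : L.Relations n → (Fin n → U) → TruthValue
  eq : U → U → TruthValue
  eq_self (d : U) : eq d d = TruthValue.tt ∨ eq d d = TruthValue.both
  eq_ne (d d' : U) : d ≠ d' → eq d d' = TruthValue.ff

section Interpretation

variable {L : FirstOrder.Language.{u, v}}

/-- The value of a term, given values for the variables. -/
def termVal (S : Struc.{u, v, w} L) {V : Type} (e : V → S.U) : L.Term V → S.U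
  | FirstOrder.Language.Term.var x => e x
  | FirstOrder.Language.Term.func f ts => S.func f fun i => termVal S e (ts i)

/-- The truth value of a formula; `α` is the assignment and `β` gives the values of the enclosing
quantified variables. -/
noncomputable def eval (S : Struc.{u, v, w} L) (α : ℕ → S.U) :
    {n : ℕ} → (Fin n → S.U) → PreFormula L n → TruthValue
  | _, _, PreFormula.falsum => TruthValue.ff
  | _, β, PreFormula.pred P ts => S.pred P fun i => termVal S (Sum.elim α β) (ts i)
  | _, β, PreFormula.equal t₁ t₂ =>
      S.eq (termVal S (Sum.elim α β) t₁) (termVal S (Sum.elim α β) t₂)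
  | _, β, PreFormula.neg A => (eval S α β A).neg
  | _, β, PreFormula.conj A₁ A₂ => (eval S α β A₁).conj (eval S α β A₂)
  | _, β, PreFormula.disj A₁ A₂ => (eval S α β A₁).disj (eval S α β A₂)
  | _, β, PreFormula.impl A₁ A₂ => (eval S α β A₁).impl (eval S α β A₂)
  | _, β, PreFormula.all A => TruthValue.all fun d => eval S α (Fin.snoc β d) A
  | _, β, PreFormula.ex A => TruthValue.ex fun d => eval S α (Fin.snoc β d) A

/-- The truth value of the formula `A` in the structure `S` under the assignment `α`. -/
noncomputable def interp (S : Struc.{u, v, w} L) (α : ℕ → S.U) (A : Formula L) : TruthValue :=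
  eval S α Fin.elim0 A

/-- `A` is a logical consequence of `Γ`. -/
def LCon (Γ : Finset (Formula L)) (A : Formula L) : Prop :=
  ∀ (S : Struc.{u, v, w} L) (α : ℕ → S.U),
    (∃ A' ∈ Γ, interp S α A' = TruthValue.ff) ∨
      interp S α A = TruthValue.tt ∨ interp S α A = TruthValue.both

/-! The next facts confirm that `forall_ x A` and `exists_ x A` are interpreted by letting the value
of the variable symbol `x` range over the domain. -/

theorem termVal_relabel (S : Struc.{u, v, w} L) {V W : Type} (g : V → W) (e : W → S.U)
    (t : L.Term V) : termVal S e (t.relabel g) = termVal S (e ∘ g) t := by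
  induction t with
  | var x => rfl
  | func f ts ih => simp [termVal, FirstOrder.Language.Term.relabel, ih]

theorem elim_comp_closeVar (S : Struc.{u, v, w} L) (α : ℕ → S.U) (x : ℕ) (d : S.U) {n : ℕ}
    (β : Fin n → S.U) :
    Sum.elim α (Fin.cons d β : Fin (n + 1) → S.U) ∘ PreFormula.closeVar x
      = Sum.elim (Function.update α x d) β := by
  funext y
  rcases y with y | i
  · by_cases h : y = x <;> simp [PreFormula.closeVar, h]
  · simp [PreFormula.closeVar]

theorem eval_close (S : Struc.{u, v, w} L) (α : ℕ → S.U) (x : ℕ) (d : S.U) {n : ℕ}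
    (A : PreFormula L n) (β : Fin n → S.U) :
    eval S α (Fin.cons d β : Fin (n + 1) → S.U) (A.close x)
      = eval S (Function.update α x d) β A := by
  induction A with
  | falsum => rfl
  | pred P ts => simp only [PreFormula.close, eval, termVal_relabel, elim_comp_closeVar]
  | equal t₁ t₂ => simp only [PreFormula.close, eval, termVal_relabel, elim_comp_closeVar]
  | neg A ih => simp only [PreFormula.close, eval, ih]
  | conj A₁ A₂ ih₁ ih₂ => simp only [PreFormula.close, eval, ih₁, ih₂]
  | disj A₁ A₂ ih₁ ih₂ => simp only [PreFormula.close, eval, ih₁, ih₂]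
  | impl A₁ A₂ ih₁ ih₂ => simp only [PreFormula.close, eval, ih₁, ih₂]
  | all A ih => simp only [PreFormula.close, eval, ← Fin.cons_snoc_eq_snoc_cons, ih]
  | ex A ih => simp only [PreFormula.close, eval, ← Fin.cons_snoc_eq_snoc_cons, ih]

theorem snoc_elim0 {U : Type w} (d : U) :
    (Fin.snoc (Fin.elim0 : Fin 0 → U) d : Fin 1 → U) = Fin.cons d (Fin.elim0 : Fin 0 → U) := by
  funext i
  fin_cases i
  rfl

theorem interp_forall (S : Struc.{u, v, w} L) (α : ℕ → S.U) (x : ℕ) (A : Formula L) :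
    interp S α (Formula.forall_ x A)
      = TruthValue.all fun d => interp S (Function.update α x d) A := by
  simp only [interp, Formula.forall_, eval, snoc_elim0, eval_close]

theorem interp_exists (S : Struc.{u, v, w} L) (α : ℕ → S.U) (x : ℕ) (A : Formula L) :
    interp S α (Formula.exists_ x A)
      = TruthValue.ex fun d => interp S (Function.update α x d) A := by
  simp only [interp, Formula.exists_, eval, snoc_elim0, eval_close]

end Interpretation

end LPif

namespace LPif

/-! Call a value designated if it is not `ff`. Soundness (`Derivable.sound`) is an induction on
derivations: every rule preserves designation under all structures and assignments. For the equality
rules this rests on `Struc.eq_ne_ff`: an equation is designated exactly when its two sides denote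
the same element.

Completeness is a Henkin argument adapted to a paraconsistent logic. If `C` is not derivable from
`Γ`, then `exists_saturated` extends `Γ` to a deductively closed, prime, witnessed set `Δ` that
omits `C`. Such a `Δ` may contain both a formula and its negation, so avoiding inconsistency is
replaced by avoiding `C`. By excluded middle and primeness, `Δ` contains `A` or `¬A` for every `A`,
so `Δ` determines one of three values: false if `A ∉ Δ`, true if `¬A ∉ Δ`, both otherwise. In the
structure of terms modulo the equations in `Δ`, the lemma `truth` shows that every formula takes
this value; hence `Γ` is designated there and `C` is not.

The two-way rules for negated compounds give most cases of `truth`. The remaining substance lies in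
`impl_mem` and `forall_mem`, and in the congruence lemmas, which are needed for negated atoms and
equations as well as for plain ones. Fresh variables serve as witnesses without enlarging the
signature; this uses weakening, which follows from invariance of derivability under renaming
(`Derivable.rename`). -/

open FirstOrder.Language (Term)

variable {L : FirstOrder.Language.{u, v}}

/-! ### Substitution and evaluation of terms -/

section Terms

theorem term_subst_congr {n : ℕ} {γ : Type} {f g : ℕ ⊕ Fin n → L.Term γ} (t : L.Term (ℕ ⊕ Fin n))
    (h : ∀ z ∈ t.varFinsetLeft, f (Sum.inl z) = g (Sum.inl z))
    (h' : ∀ i, f (Sum.inr i) = g (Sum.inr i)) : t.subst f = t.subst g := by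
  induction t with
  | var x =>
    rcases x with z | i
    · exact h z (by simp [Term.varFinsetLeft])
    · exact h' i
  | func F ts ih =>
    simp only [Term.subst, Term.func.injEq, heq_eq_eq, true_and]
    funext i
    exact ih i fun z hz => h z (by simpa [Term.varFinsetLeft] using ⟨i, hz⟩)

theorem term_relabel_eq_subst {β γ : Type} (g : β → γ) (t : L.Term β) :
    t.relabel g = t.subst fun b => Term.var (g b) := by
  induction t with
  | var x => rfl
  | func F ts ih => simp [Term.subst, Term.relabel, ih]

theorem term_subst_subst {β γ δ : Type} (f : β → L.Term γ) (g : γ → L.Term δ) (t : L.Term β) :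
    (t.subst f).subst g = t.subst fun b => (f b).subst g := by
  induction t with
  | var x => rfl
  | func F ts ih => simp [Term.subst, ih]

theorem term_subst_var {β : Type} (t : L.Term β) : t.subst Term.var = t := by
  induction t with
  | var x => rfl
  | func F ts ih => simp [Term.subst, ih]

theorem termVal_subst (S : Struc.{u, v, w} L) {V W : Type} (g : V → L.Term W) (e : W → S.U)
    (t : L.Term V) : termVal S e (t.subst g) = termVal S (fun x => termVal S e (g x)) t := by
  induction t with
  | var x => rfl
  | func f ts ih => simp [termVal, Term.subst, ih]

end Terms

/-! ### Substitution, renaming and binding in formulas; countability -/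

namespace PreFormula

/-- What the simultaneous substitution `σ` puts in place of a variable. -/
def instVar (σ : ℕ → L.Term ℕ) {n : ℕ} : ℕ ⊕ Fin n → L.Term (ℕ ⊕ Fin n)
  | Sum.inl y => (σ y).relabel Sum.inl
  | Sum.inr i => Term.var (Sum.inr i)

/-- Simultaneous substitution of terms for the free variables of a formula. -/
def inst (σ : ℕ → L.Term ℕ) : {n : ℕ} → PreFormula L n → PreFormula L n
  | _, falsum => falsum
  | _, pred P ts => pred P fun i => (ts i).subst (instVar σ)
  | _, equal t₁ t₂ => equal (t₁.subst (instVar σ)) (t₂.subst (instVar σ))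
  | _, neg A => neg (inst σ A)
  | _, conj A₁ A₂ => conj (inst σ A₁) (inst σ A₂)
  | _, disj A₁ A₂ => disj (inst σ A₁) (inst σ A₂)
  | _, impl A₁ A₂ => impl (inst σ A₁) (inst σ A₂)
  | _, all A => all (inst σ A)
  | _, ex A => ex (inst σ A)

/-- The number of connectives and quantifiers of a formula. -/
def size : {n : ℕ} → PreFormula L n → ℕ
  | _, falsum => 0
  | _, pred _ _ => 0
  | _, equal _ _ => 0
  | _, neg A => size A + 1
  | _, conj A₁ A₂ => size A₁ + size A₂ + 1
  | _, disj A₁ A₂ => size A₁ + size A₂ + 1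
  | _, impl A₁ A₂ => size A₁ + size A₂ + 1
  | _, all A => size A + 1
  | _, ex A => size A + 1

theorem instVar_substVar (x : ℕ) (t : L.Term ℕ) {n : ℕ} :
    (substVar x t : ℕ ⊕ Fin n → _) = instVar (Function.update Term.var x t) := by
  funext y
  rcases y with y | i
  · by_cases h : y = x
    · subst h; simp [substVar, instVar]
    · simp [substVar, instVar, h, Term.relabel]
  · rfl

/-- Simultaneous substitutions compose, unlike single ones, so laws of single substitution are
derived from those of `inst`. -/
theorem subst_eq_inst (x : ℕ) (t : L.Term ℕ) {n : ℕ} (A : PreFormula L n) :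
    A.subst x t = A.inst (Function.update Term.var x t) := by
  induction A with
  | falsum => rfl
  | pred P ts => simp only [subst, inst, instVar_substVar]
  | equal t₁ t₂ => simp only [subst, inst, instVar_substVar]
  | neg A ih => simp only [subst, inst, ih]
  | conj A₁ A₂ ih₁ ih₂ => simp only [subst, inst, ih₁, ih₂]
  | disj A₁ A₂ ih₁ ih₂ => simp only [subst, inst, ih₁, ih₂]
  | impl A₁ A₂ ih₁ ih₂ => simp only [subst, inst, ih₁, ih₂]
  | all A ih => simp only [subst, inst, ih]
  | ex A ih => simp only [subst, inst, ih]

theorem inst_congr {σ τ : ℕ → L.Term ℕ} {n : ℕ} (A : PreFormula L n)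
    (h : ∀ z ∈ A.free, σ z = τ z) : A.inst σ = A.inst τ := by
  induction A with
  | falsum => rfl
  | pred P ts =>
    simp only [inst, pred.injEq, heq_eq_eq, true_and]
    funext i
    exact term_subst_congr _ (fun z hz => by simp [instVar, h z ⟨i, hz⟩]) fun _ => rfl
  | equal t₁ t₂ =>
    simp only [inst, equal.injEq]
    exact ⟨term_subst_congr _ (fun z hz => by simp [instVar, h z (Or.inl hz)]) fun _ => rfl,
      term_subst_congr _ (fun z hz => by simp [instVar, h z (Or.inr hz)]) fun _ => rfl⟩
  | neg A ih => simp only [inst, ih h]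
  | conj A₁ A₂ ih₁ ih₂ =>
    simp only [inst, ih₁ fun z hz => h z (Or.inl hz), ih₂ fun z hz => h z (Or.inr hz)]
  | disj A₁ A₂ ih₁ ih₂ =>
    simp only [inst, ih₁ fun z hz => h z (Or.inl hz), ih₂ fun z hz => h z (Or.inr hz)]
  | impl A₁ A₂ ih₁ ih₂ =>
    simp only [inst, ih₁ fun z hz => h z (Or.inl hz), ih₂ fun z hz => h z (Or.inr hz)]
  | all A ih => simp only [inst, ih h]
  | ex A ih => simp only [inst, ih h]

theorem term_subst_instVar_instVar (σ τ : ℕ → L.Term ℕ) {n : ℕ} (t : L.Term (ℕ ⊕ Fin n)) :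
    (t.subst (instVar σ)).subst (instVar τ) = t.subst (instVar fun z => (σ z).subst τ) := by
  rw [term_subst_subst]
  refine term_subst_congr _ (fun z _ => ?_) fun _ => rfl
  simp only [instVar, term_relabel_eq_subst, term_subst_subst, Term.subst]

theorem inst_inst (σ τ : ℕ → L.Term ℕ) {n : ℕ} (A : PreFormula L n) :
    (A.inst σ).inst τ = A.inst fun z => (σ z).subst τ := by
  induction A with
  | falsum => rfl
  | pred P ts => simp only [inst, term_subst_instVar_instVar]
  | equal t₁ t₂ => simp only [inst, term_subst_instVar_instVar]
  | neg A ih => simp only [inst, ih]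
  | conj A₁ A₂ ih₁ ih₂ => simp only [inst, ih₁, ih₂]
  | disj A₁ A₂ ih₁ ih₂ => simp only [inst, ih₁, ih₂]
  | impl A₁ A₂ ih₁ ih₂ => simp only [inst, ih₁, ih₂]
  | all A ih => simp only [inst, ih]
  | ex A ih => simp only [inst, ih]

theorem term_subst_instVar_var {n : ℕ} (t : L.Term (ℕ ⊕ Fin n)) :
    t.subst (instVar Term.var) = t := by
  conv_rhs => rw [← term_subst_var t]
  exact term_subst_congr _ (fun _ _ => rfl) fun _ => rfl

theorem inst_var {n : ℕ} (A : PreFormula L n) : A.inst Term.var = A := by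
  induction A with
  | falsum => rfl
  | pred P ts => simp only [inst, term_subst_instVar_var]
  | equal t₁ t₂ => simp only [inst, term_subst_instVar_var]
  | neg A ih => simp only [inst, ih]
  | conj A₁ A₂ ih₁ ih₂ => simp only [inst, ih₁, ih₂]
  | disj A₁ A₂ ih₁ ih₂ => simp only [inst, ih₁, ih₂]
  | impl A₁ A₂ ih₁ ih₂ => simp only [inst, ih₁, ih₂]
  | all A ih => simp only [inst, ih]
  | ex A ih => simp only [inst, ih]

theorem subst_var_self (x : ℕ) {n : ℕ} (A : PreFormula L n) : A.subst x (Term.var x) = A := by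
  rw [subst_eq_inst, Function.update_eq_self, inst_var]

theorem subst_of_notMem_free (x : ℕ) (t : L.Term ℕ) {n : ℕ} (A : PreFormula L n)
    (h : x ∉ A.free) : A.subst x t = A := by
  conv_rhs => rw [← inst_var A]
  rw [subst_eq_inst]
  refine inst_congr _ fun z hz => Function.update_of_ne ?_ _ _
  rintro rfl
  exact h hz

/-- Renaming of the free variables of a formula. -/
def rename (ρ : ℕ → ℕ) {n : ℕ} (A : PreFormula L n) : PreFormula L n :=
  A.inst fun z => Term.var (ρ z)

theorem rename_id {n : ℕ} (A : PreFormula L n) : A.rename id = A := inst_var A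

/-- Allows a renaming to be redefined at an eigenvariable without disturbing the formulas in which
that variable is not free. -/
theorem rename_update_of_notMem {ρ : ℕ → ℕ} {x y n : ℕ} {A : PreFormula L n} (h : x ∉ A.free) :
    A.rename (Function.update ρ x y) = A.rename ρ := by
  refine inst_congr _ fun z hz => ?_
  rw [Function.update_of_ne]
  rintro rfl
  exact h hz

/-- The hypothesis excludes capture: a variable other than `x` that is sent to `y` would be bound on
the right but not on the left. -/
theorem term_close_rename (ρ : ℕ → ℕ) (x y : ℕ) {n : ℕ} (t : L.Term (ℕ ⊕ Fin n))
    (h : ∀ z ∈ t.varFinsetLeft, z ≠ x → ρ z ≠ y) :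
    (t.relabel (closeVar x)).subst (instVar fun z => Term.var (ρ z))
      = (t.subst (instVar fun z => Term.var (Function.update ρ x y z))).relabel (closeVar y) := by
  rw [term_relabel_eq_subst, term_relabel_eq_subst, term_subst_subst, term_subst_subst]
  refine term_subst_congr _ (fun z hz => ?_) fun _ => rfl
  by_cases hx : z = x
  · subst hx; simp [closeVar, instVar, Term.subst, Term.relabel]
  · simp [closeVar, instVar, Term.subst, Term.relabel, hx, h z hz hx]

/-- Renaming commutes with binding a variable, up to the choice of that variable. -/
theorem rename_close (ρ : ℕ → ℕ) (x y : ℕ) {n : ℕ} (A : PreFormula L n)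
    (h : ∀ z ∈ A.free, z ≠ x → ρ z ≠ y) :
    (A.close x).rename ρ = (A.rename (Function.update ρ x y)).close y := by
  unfold rename
  induction A with
  | falsum => rfl
  | pred P ts =>
    simp only [inst, close, pred.injEq, heq_eq_eq, true_and]
    funext i
    exact term_close_rename _ _ _ _ fun z hz => h z ⟨i, hz⟩
  | equal t₁ t₂ =>
    simp only [inst, close, equal.injEq]
    exact ⟨term_close_rename _ _ _ _ fun z hz => h z (Or.inl hz),
      term_close_rename _ _ _ _ fun z hz => h z (Or.inr hz)⟩
  | neg A ih => simp only [inst, close, ih h]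
  | conj A₁ A₂ ih₁ ih₂ =>
    simp only [inst, close, ih₁ fun z hz => h z (Or.inl hz), ih₂ fun z hz => h z (Or.inr hz)]
  | disj A₁ A₂ ih₁ ih₂ =>
    simp only [inst, close, ih₁ fun z hz => h z (Or.inl hz), ih₂ fun z hz => h z (Or.inr hz)]
  | impl A₁ A₂ ih₁ ih₂ =>
    simp only [inst, close, ih₁ fun z hz => h z (Or.inl hz), ih₂ fun z hz => h z (Or.inr hz)]
  | all A ih => simp only [inst, close, ih h]
  | ex A ih => simp only [inst, close, ih h]

/-- Renaming commutes with substitution, up to the choice of the substituted variable. -/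
theorem rename_subst (ρ : ℕ → ℕ) (x y : ℕ) (t : L.Term ℕ) {n : ℕ} (A : PreFormula L n)
    (h : ∀ z ∈ A.free, z ≠ x → ρ z ≠ y) :
    (A.subst x t).rename ρ
      = (A.rename (Function.update ρ x y)).subst y (t.relabel ρ) := by
  rw [subst_eq_inst, subst_eq_inst, rename, rename, inst_inst, inst_inst]
  refine inst_congr _ fun z hz => ?_
  by_cases hx : z = x
  · subst hx; simp [Term.subst, term_relabel_eq_subst]
  · simp [Term.subst, hx, h z hz hx]

/-- Renaming of the bound variable, in the form that lets a fresh `y` act as the eigenvariable of a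
quantifier over `x`. -/
theorem close_subst_var (x y : ℕ) {n : ℕ} (A : PreFormula L n) (h : y ∉ A.free) :
    (A.subst x (Term.var y)).close y = A.close x := by
  have := rename_close id x y A (by rintro z hz - rfl; exact h hz)
  rw [rename_id] at this
  rw [this, subst_eq_inst, rename]
  congr 2
  funext z
  by_cases hx : z = x
  · subst hx; simp
  · simp [hx]

theorem finite_free {n : ℕ} (A : PreFormula L n) : A.free.Finite := by
  induction A with
  | falsum => exact Set.finite_empty
  | pred P ts =>
    have : (free (pred P ts)) = ⋃ i, (↑(ts i).varFinsetLeft : Set ℕ) := by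
      ext z; simp [free]
    rw [this]
    exact Set.finite_iUnion fun i => Finset.finite_toSet _
  | equal t₁ t₂ => exact (Finset.finite_toSet _).union (Finset.finite_toSet _)
  | neg A ih => exact ih
  | conj A₁ A₂ ih₁ ih₂ => exact ih₁.union ih₂
  | disj A₁ A₂ ih₁ ih₂ => exact ih₁.union ih₂
  | impl A₁ A₂ ih₁ ih₂ => exact ih₁.union ih₂
  | all A ih => exact ih
  | ex A ih => exact ih

theorem notMem_varFinsetLeft_closeVar (x : ℕ) {n : ℕ} (t : L.Term (ℕ ⊕ Fin n)) :
    x ∉ (t.relabel (closeVar x)).varFinsetLeft := by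
  induction t with
  | var y =>
    rcases y with y | i
    · by_cases h : y = x
      · simp [Term.relabel, closeVar, h, Term.varFinsetLeft]
      · simp [Term.relabel, closeVar, h, Term.varFinsetLeft, Ne.symm h]
    · simp [Term.relabel, closeVar, Term.varFinsetLeft]
  | func F ts ih => simpa [Term.relabel, Term.varFinsetLeft] using ih

theorem notMem_free_close (x : ℕ) {n : ℕ} (A : PreFormula L n) : x ∉ (A.close x).free := by
  induction A with
  | falsum => exact Set.notMem_empty _
  | pred P ts => rintro ⟨i, hi⟩; exact notMem_varFinsetLeft_closeVar _ _ hi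
  | equal t₁ t₂ =>
    rintro (h | h)
    · exact notMem_varFinsetLeft_closeVar _ _ h
    · exact notMem_varFinsetLeft_closeVar _ _ h
  | neg A ih => exact ih
  | conj A₁ A₂ ih₁ ih₂ => exact fun h => h.elim ih₁ ih₂
  | disj A₁ A₂ ih₁ ih₂ => exact fun h => h.elim ih₁ ih₂
  | impl A₁ A₂ ih₁ ih₂ => exact fun h => h.elim ih₁ ih₂
  | all A ih => exact ih
  | ex A ih => exact ih

theorem exists_term_close_eq (x : ℕ) {n : ℕ} (t : L.Term (ℕ ⊕ Fin (n + 1)))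
    (h : x ∉ t.varFinsetLeft) : ∃ s : L.Term (ℕ ⊕ Fin n), s.relabel (closeVar x) = t := by
  -- The relabelling inverts `closeVar x`: it sends the outermost reference back to `x` and lowers
  -- the others by one.
  refine ⟨t.relabel (Sum.elim Sum.inl (Fin.cases (Sum.inl x) Sum.inr)), ?_⟩
  conv_rhs => rw [← term_subst_var t]
  rw [term_relabel_eq_subst, term_relabel_eq_subst, term_subst_subst]
  refine term_subst_congr _ (fun z hz => ?_) fun i => ?_
  · have : z ≠ x := by rintro rfl; exact h hz
    simp [Term.subst, closeVar, this]
  · cases i using Fin.cases <;> simp [Term.subst, closeVar]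

/-- Every formula in the scope of a quantifier arises by binding a given fresh variable. -/
theorem exists_close_eq (x : ℕ) {m : ℕ} (B : PreFormula L m) (h : x ∉ B.free) :
    ∀ {n : ℕ} (e : m = n + 1), ∃ A : PreFormula L n, A.close x = e ▸ B := by
  -- The index `m` of `B` is kept a variable, tied to `n + 1` only by `e`, so that induction on `B`
  -- is possible.
  induction B with
  | falsum => rintro n rfl; exact ⟨falsum, rfl⟩
  | pred P ts =>
    rintro n rfl
    choose s hs using fun i => exists_term_close_eq x (ts i) fun hi => h ⟨i, hi⟩
    exact ⟨pred P s, by simp [close, hs]⟩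
  | equal t₁ t₂ =>
    rintro n rfl
    obtain ⟨s₁, rfl⟩ := exists_term_close_eq x t₁ fun hi => h (Or.inl hi)
    obtain ⟨s₂, rfl⟩ := exists_term_close_eq x t₂ fun hi => h (Or.inr hi)
    exact ⟨equal s₁ s₂, rfl⟩
  | neg A ih =>
    rintro n rfl
    obtain ⟨A', h'⟩ := ih h rfl
    exact ⟨neg A', by simp [close, h']⟩
  | conj A₁ A₂ ih₁ ih₂ =>
    rintro n rfl
    obtain ⟨A', h'⟩ := ih₁ (fun hi => h (Or.inl hi)) rfl
    obtain ⟨A'', h''⟩ := ih₂ (fun hi => h (Or.inr hi)) rfl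
    exact ⟨conj A' A'', by simp [close, h', h'']⟩
  | disj A₁ A₂ ih₁ ih₂ =>
    rintro n rfl
    obtain ⟨A', h'⟩ := ih₁ (fun hi => h (Or.inl hi)) rfl
    obtain ⟨A'', h''⟩ := ih₂ (fun hi => h (Or.inr hi)) rfl
    exact ⟨disj A' A'', by simp [close, h', h'']⟩
  | impl A₁ A₂ ih₁ ih₂ =>
    rintro n rfl
    obtain ⟨A', h'⟩ := ih₁ (fun hi => h (Or.inl hi)) rfl
    obtain ⟨A'', h''⟩ := ih₂ (fun hi => h (Or.inr hi)) rfl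
    exact ⟨impl A' A'', by simp [close, h', h'']⟩
  | all A ih =>
    rintro n rfl
    obtain ⟨A', h'⟩ := ih h rfl
    exact ⟨all A', by simp [close, h']⟩
  | ex A ih =>
    rintro n rfl
    obtain ⟨A', h'⟩ := ih h rfl
    exact ⟨ex A', by simp [close, h']⟩

theorem size_close (x : ℕ) {n : ℕ} (A : PreFormula L n) : (A.close x).size = A.size := by
  induction A <;> simp_all [close, size]

theorem size_subst (x : ℕ) (t : L.Term ℕ) {n : ℕ} (A : PreFormula L n) :
    (A.subst x t).size = A.size := by
  induction A <;> simp_all [subst, size]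

/-- Over a countable signature there are countably many formulas. -/
theorem countable [∀ n, Countable (L.Functions n)] [∀ n, Countable (L.Relations n)] (n : ℕ) :
    Countable (PreFormula L n) := by
  have hT : ∀ n k, Countable (Fin k → L.Term (ℕ ⊕ Fin n)) := fun n k => inferInstance
  have hP : ∀ n, Countable (Σ k, L.Relations k × (Fin k → L.Term (ℕ ⊕ Fin n))) :=
    fun n => inferInstance
  have hE : ∀ n, Countable (L.Term (ℕ ⊕ Fin n) × L.Term (ℕ ⊕ Fin n)) := fun n => inferInstance
  choose p hp using fun n => (hP n).exists_injective_nat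
  choose q hq using fun n => (hE n).exists_injective_nat
  -- A formula is coded by a tag for its outermost constructor, paired with codes of its parts.
  -- Injectivity is claimed only for fixed `n`, so the codings `p n` and `q n` of atoms may depend
  -- on `n`.
  let code : {n : ℕ} → PreFormula L n → ℕ := fun {n} A => PreFormula.rec (motive := fun _ _ => ℕ)
    (Nat.pair 0 0) (fun {n k} P ts => Nat.pair 1 (p n ⟨k, P, ts⟩))
    (fun {n} t₁ t₂ => Nat.pair 2 (q n (t₁, t₂))) (fun _ a => Nat.pair 3 a)
    (fun _ _ a b => Nat.pair 4 (Nat.pair a b)) (fun _ _ a b => Nat.pair 5 (Nat.pair a b))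
    (fun _ _ a b => Nat.pair 6 (Nat.pair a b)) (fun _ a => Nat.pair 7 a)
    (fun _ a => Nat.pair 8 a) A
  refine ⟨⟨code, fun A => ?_⟩⟩
  induction A with
  | falsum => intro B h; cases B <;> simp [code, Nat.pair_eq_pair] at h ⊢
  | pred P ts =>
    intro B h
    cases B <;> simp [code, Nat.pair_eq_pair, (hp _).eq_iff] at h ⊢
    obtain ⟨rfl, h⟩ := h
    simpa using h
  | equal t₁ t₂ =>
    intro B h
    cases B <;> simp [code, Nat.pair_eq_pair, (hq _).eq_iff] at h ⊢
    exact h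
  | neg A ih =>
    intro B h
    cases B <;> simp [code, Nat.pair_eq_pair] at h ⊢
    exact ih h
  | conj A₁ A₂ ih₁ ih₂ =>
    intro B h
    cases B <;> simp [code, Nat.pair_eq_pair] at h ⊢
    exact ⟨ih₁ h.1, ih₂ h.2⟩
  | disj A₁ A₂ ih₁ ih₂ =>
    intro B h
    cases B <;> simp [code, Nat.pair_eq_pair] at h ⊢
    exact ⟨ih₁ h.1, ih₂ h.2⟩
  | impl A₁ A₂ ih₁ ih₂ =>
    intro B h
    cases B <;> simp [code, Nat.pair_eq_pair] at h ⊢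
    exact ⟨ih₁ h.1, ih₂ h.2⟩
  | all A ih =>
    intro B h
    cases B <;> simp [code, Nat.pair_eq_pair] at h ⊢
    exact ih h
  | ex A ih =>
    intro B h
    cases B <;> simp [code, Nat.pair_eq_pair] at h ⊢
    exact ih h

end PreFormula

theorem finite_freeVars (Γ : Finset (Formula L)) : (freeVars Γ).Finite :=
  Γ.finite_toSet.biUnion fun A _ => A.finite_free

/-! ### Derivations as sequences and as trees -/

/-- The sequents obtained from the inference rules, as an inductive predicate. -/
inductive Derivable : Sequent L → Prop
  | rule {ps : List (Sequent L)} {s : Sequent L} (hr : Rule ps s)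
      (hp : ∀ p ∈ ps, Derivable p) : Derivable s

theorem derivable_of_isDerivation {l : List (Sequent L)} {s : Sequent L}
    (h : IsDerivation ∅ l s) : Derivable s := by
  have key : ∀ (k : ℕ) (hk : k < l.length), Derivable (l.get ⟨k, hk⟩) := by
    intro k
    induction k using Nat.strong_induction_on with
    | _ k ih =>
      intro hk
      obtain h' | ⟨ps, hr, hp⟩ := h.2 ⟨k, hk⟩
      · exact h'.elim
      · refine .rule hr fun p hm => ?_
        obtain ⟨j, hj, rfl⟩ := hp p hm
        exact ih j hj j.2
  obtain ⟨k, hk, rfl⟩ := List.getElem_of_mem (List.mem_of_getLast? h.1)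
  exact key k hk

/-- Each entry of `l` is the conclusion of a rule instance with premises earlier in `l`. -/
def Justified (l : List (Sequent L)) : Prop :=
  ∀ (k : ℕ) (s : Sequent L), l[k]? = some s →
    ∃ ps, Rule ps s ∧ ∀ p ∈ ps, ∃ j < k, l[j]? = some p

theorem Justified.append {l l' : List (Sequent L)} (h : Justified l) (h' : Justified l') :
    Justified (l ++ l') := by
  intro k s hs
  rcases lt_or_ge k l.length with hk | hk
  · rw [List.getElem?_append_left hk] at hs
    obtain ⟨ps, hr, hp⟩ := h k s hs
    refine ⟨ps, hr, fun p hm => ?_⟩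
    obtain ⟨j, hj, e⟩ := hp p hm
    exact ⟨j, hj, by rw [List.getElem?_append_left (hj.trans hk), e]⟩
  · rw [List.getElem?_append_right hk] at hs
    obtain ⟨ps, hr, hp⟩ := h' _ s hs
    refine ⟨ps, hr, fun p hm => ?_⟩
    obtain ⟨j, hj, e⟩ := hp p hm
    refine ⟨l.length + j, by omega, ?_⟩
    rw [List.getElem?_append_right (by omega), Nat.add_sub_cancel_left, e]

theorem Justified.concat {l ps : List (Sequent L)} {s : Sequent L} (h : Justified l)
    (hr : Rule ps s) (hp : ∀ p ∈ ps, p ∈ l) : Justified (l ++ [s]) := by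
  intro k t ht
  rcases lt_or_ge k l.length with hk | hk
  · rw [List.getElem?_append_left hk] at ht
    obtain ⟨qs, hq, hp⟩ := h k t ht
    refine ⟨qs, hq, fun p hm => ?_⟩
    obtain ⟨j, hj, e⟩ := hp p hm
    exact ⟨j, hj, by rw [List.getElem?_append_left (hj.trans hk), e]⟩
  · rw [List.getElem?_append_right hk, List.getElem?_singleton] at ht
    split_ifs at ht
    cases ht
    refine ⟨ps, hr, fun p hm => ?_⟩
    obtain ⟨j, hj, rfl⟩ := List.getElem_of_mem (hp p hm)
    exact ⟨j, by omega, by rw [List.getElem?_append_left hj, List.getElem?_eq_getElem hj]⟩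

/-- Justifications only point backwards, so derivations of the premises can be concatenated and the
conclusion appended. -/
theorem Derivable.exists_justified {s : Sequent L} (h : Derivable s) :
    ∃ l, Justified (l ++ [s]) := by
  induction h with
  | @rule ps s hr hp ih =>
    have key : ∀ qs : List (Sequent L), (∀ q ∈ qs, ∃ l, Justified (l ++ [q])) →
        ∃ l, Justified l ∧ ∀ q ∈ qs, q ∈ l := by
      intro qs
      induction qs with
      | nil => exact fun _ => ⟨[], by simp [Justified], by simp⟩
      | cons q qs ih =>
        intro h
        obtain ⟨l, hl, hq⟩ := ih fun q' hq' => h q' (List.mem_cons_of_mem _ hq')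
        obtain ⟨l', hl'⟩ := h q List.mem_cons_self
        refine ⟨l ++ (l' ++ [q]), hl.append hl', ?_⟩
        intro q' hq'
        rcases List.mem_cons.1 hq' with rfl | hq'
        · simp
        · simp [hq q' hq']
    obtain ⟨l, hl, hq⟩ := key ps ih
    exact ⟨l, hl.concat hr hq⟩

theorem provable_iff_derivable (Γ : Finset (Formula L)) (A : Formula L) :
    Provable Γ A ↔ Derivable ⟨Γ, A⟩ := by
  refine ⟨fun ⟨l, hl⟩ => derivable_of_isDerivation hl, fun h => ?_⟩
  obtain ⟨l, hl⟩ := h.exists_justified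
  refine ⟨l ++ [⟨Γ, A⟩], List.getLast?_concat, fun i => Or.inr ?_⟩
  obtain ⟨ps, hr, hp⟩ := hl i _ (List.getElem?_eq_getElem i.2)
  refine ⟨ps, hr, fun p hm => ?_⟩
  obtain ⟨j, hj, e⟩ := hp p hm
  obtain ⟨hj', e'⟩ := List.getElem?_eq_some_iff.1 e
  exact ⟨⟨j, hj'⟩, hj, e'⟩

theorem Derivable.of_mem {Γ : Finset (Formula L)} {A : Formula L} (h : A ∈ Γ) :
    Derivable ⟨Γ, A⟩ := by
  rw [← Finset.insert_eq_of_mem h]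
  exact .rule (.ident Γ A) (by simp)

theorem Derivable.nullary_rule {s : Sequent L} (hr : Rule [] s) : Derivable s :=
  .rule hr (by simp)

theorem Derivable.unary_rule {s p : Sequent L} (hr : Rule [p] s) (h : Derivable p) :
    Derivable s :=
  .rule hr (by simpa using h)

theorem Derivable.binary_rule {s p q : Sequent L} (hr : Rule [p, q] s) (h : Derivable p)
    (h' : Derivable q) : Derivable s :=
  .rule hr (by simpa using ⟨h, h'⟩)

theorem Derivable.ternary_rule {s p q r : Sequent L} (hr : Rule [p, q, r] s) (h : Derivable p)
    (h' : Derivable q) (h'' : Derivable r) : Derivable s :=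
  .rule hr (by simpa using ⟨h, h', h''⟩)

/-! ### Renaming, weakening and cut -/

section Weakening

open PreFormula Formula

theorem rename_eq (ρ : ℕ → ℕ) (t₁ t₂ : L.Term ℕ) :
    (Formula.eq t₁ t₂).rename ρ = Formula.eq (t₁.relabel ρ) (t₂.relabel ρ) := by
  simp only [PreFormula.rename, Formula.eq, inst, term_relabel_eq_subst, term_subst_subst,
    Term.subst, instVar]

theorem rename_forall {ρ : ℕ → ℕ} {x y : ℕ} {A : Formula L}
    (h : ∀ z ∈ A.free, z ≠ x → ρ z ≠ y) :
    (forall_ x A).rename ρ = forall_ y (A.rename (Function.update ρ x y)) :=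
  congrArg PreFormula.all (rename_close ρ x y A h)

theorem rename_exists {ρ : ℕ → ℕ} {x y : ℕ} {A : Formula L}
    (h : ∀ z ∈ A.free, z ≠ x → ρ z ≠ y) :
    (exists_ x A).rename ρ = exists_ y (A.rename (Function.update ρ x y)) :=
  congrArg PreFormula.ex (rename_close ρ x y A h)

/-- The two requirements on `y` serve different ends: avoiding `Γ` gives the eigenvariable
condition, and avoiding the image of `A.free` under `ρ` prevents capture. -/
theorem exists_fresh (ρ : ℕ → ℕ) (Γ : Finset (Formula L)) (A : Formula L) :
    ∃ y, y ∉ freeVars Γ ∧ ∀ z ∈ A.free, ρ z ≠ y := by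
  obtain ⟨y, hy⟩ := ((finite_freeVars Γ).union (A.finite_free.image ρ)).exists_notMem
  refine ⟨y, fun h => hy (Or.inl h), ?_⟩
  rintro z hz rfl
  exact hy (Or.inr ⟨z, hz, rfl⟩)

/-- Derivability is preserved by renaming free variables and enlarging the left side. -/
theorem Derivable.rename {s : Sequent L} (h : Derivable s) :
    ∀ (ρ : ℕ → ℕ) (Γ : Finset (Formula L)), (∀ B ∈ s.left, B.rename ρ ∈ Γ) →
      Derivable ⟨Γ, s.right.rename ρ⟩ := by
  have ins : ∀ {ρ : ℕ → ℕ} {Δ Γ : Finset (Formula L)} (A : Formula L),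
      (∀ B ∈ Δ, B.rename ρ ∈ Γ) → ∀ B ∈ insert A Δ, B.rename ρ ∈ insert (A.rename ρ) Γ := by
    intro ρ Δ Γ A h B hB
    rcases Finset.mem_insert.1 hB with rfl | hB
    · exact Finset.mem_insert_self _ _
    · exact Finset.mem_insert_of_mem (h B hB)
  have upd : ∀ {ρ : ℕ → ℕ} {Δ Γ : Finset (Formula L)} {x : ℕ} (y : ℕ), x ∉ freeVars Δ →
      (∀ B ∈ Δ, B.rename ρ ∈ Γ) → ∀ B ∈ Δ, B.rename (Function.update ρ x y) ∈ Γ := by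
    intro ρ Δ Γ x y hx h B hB
    rw [rename_update_of_notMem]
    · exact h B hB
    · exact fun hx' => hx (Set.mem_biUnion hB hx')
  induction h with
  | @rule ps s hr hp ih =>
    clear hp
    intro ρ Γ hΓ
    cases hr with
    | ident Δ A => exact .of_mem (hΓ A (Finset.mem_insert_self _ _))
    | trueI => exact .nullary_rule (.trueI _)
    | em Δ A => exact .nullary_rule (.em _ _)
    | falseE Δ A => exact .unary_rule (.falseE _ _) (ih _ List.mem_cons_self ρ Γ hΓ)
    | conjI Δ A B =>
      exact .binary_rule (.conjI _ _ _) (ih _ List.mem_cons_self ρ Γ hΓ)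
        (ih ⟨Δ, B⟩ (by simp) ρ Γ hΓ)
    | conjE₁ Δ A B => exact .unary_rule (.conjE₁ _ _ (B.rename ρ)) (ih _ List.mem_cons_self ρ Γ hΓ)
    | conjE₂ Δ A B => exact .unary_rule (.conjE₂ _ (A.rename ρ) _) (ih _ List.mem_cons_self ρ Γ hΓ)
    | disjI₁ Δ A B => exact .unary_rule (.disjI₁ _ _ _) (ih _ List.mem_cons_self ρ Γ hΓ)
    | disjI₂ Δ A B => exact .unary_rule (.disjI₂ _ _ _) (ih _ List.mem_cons_self ρ Γ hΓ)
    | disjE Δ A B C =>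
      exact .ternary_rule (.disjE _ (A.rename ρ) (B.rename ρ) _)
        (ih ⟨Δ, disj A B⟩ (by simp) ρ Γ hΓ)
        (ih ⟨insert A Δ, C⟩ (by simp) ρ _ (ins A hΓ))
        (ih ⟨insert B Δ, C⟩ (by simp) ρ _ (ins B hΓ))
    | implI Δ A B => exact .unary_rule (.implI _ _ _) (ih _ List.mem_cons_self ρ _ (ins A hΓ))
    | implE Δ A B =>
      exact .binary_rule (.implE _ (A.rename ρ) _) (ih ⟨Δ, impl A B⟩ (by simp) ρ Γ hΓ)
        (ih ⟨Δ, A⟩ (by simp) ρ Γ hΓ)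
    | forallI Δ x A hx =>
      -- The eigenvariable `x` may be free in the enlarged `Γ`. It is exchanged for a fresh `y` by
      -- applying the induction hypothesis to `ρ` updated at `x`; this is why the induction ranges
      -- over all renamings.
      obtain ⟨y, hy, hy'⟩ := exists_fresh ρ Γ A
      rw [rename_forall (y := y) fun z hz _ => hy' z hz]
      exact .unary_rule (.forallI _ _ _ hy) (ih ⟨Δ, A⟩ (by simp) _ _ (upd y hx hΓ))
    | forallE Δ x t A =>
      obtain ⟨y, hy, hy'⟩ := exists_fresh ρ Γ A
      have := ih _ List.mem_cons_self ρ Γ hΓ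
      rw [rename_forall (y := y) fun z hz _ => hy' z hz] at this
      rw [rename_subst (y := y) _ _ _ _ fun z hz _ => hy' z hz]
      exact .unary_rule (.forallE _ _ _ _) this
    | existsI Δ x t A =>
      obtain ⟨y, hy, hy'⟩ := exists_fresh ρ Γ A
      have := ih _ List.mem_cons_self ρ Γ hΓ
      rw [rename_subst (y := y) _ _ _ _ fun z hz _ => hy' z hz] at this
      rw [rename_exists (y := y) fun z hz _ => hy' z hz]
      exact .unary_rule (.existsI _ _ _ _) this
    | existsE Δ x A B hx =>
      obtain ⟨y, hy, hy'⟩ := exists_fresh ρ (Γ ∪ {B.rename ρ}) A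
      have hx₁ : x ∉ freeVars Δ := fun h => hx (by
        simp only [freeVars, Set.mem_iUnion] at h ⊢
        obtain ⟨C, hC, h⟩ := h
        exact ⟨C, Finset.mem_union_left _ hC, h⟩)
      have hx₂ : x ∉ B.free := fun h => hx (Set.mem_biUnion (x := B) (by simp) h)
      have h₁ := ih ⟨Δ, exists_ x A⟩ (by simp) ρ Γ hΓ
      have h₂ := ih ⟨insert A Δ, B⟩ (by simp) (Function.update ρ x y) _
        (ins A (upd y hx₁ hΓ))
      rw [rename_exists (y := y) fun z hz _ => hy' z hz] at h₁
      rw [rename_update_of_notMem hx₂] at h₂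
      exact .binary_rule (.existsE _ _ _ _ hy) h₁ h₂
    | eqI Δ t =>
      rw [rename_eq]
      exact .nullary_rule (.eqI _ _)
    | eqE Δ x t₁ t₂ A =>
      obtain ⟨y, hy, hy'⟩ := exists_fresh ρ Γ A
      have h₁ := ih ⟨Δ, Formula.eq t₁ t₂⟩ (by simp) ρ Γ hΓ
      have h₂ := ih ⟨Δ, A.subst x t₁⟩ (by simp) ρ Γ hΓ
      rw [rename_eq] at h₁
      rw [rename_subst (y := y) _ _ _ _ fun z hz _ => hy' z hz] at h₂ ⊢
      exact .binary_rule (.eqE _ _ _ _ _) h₁ h₂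
    | negM Δ A => exact .unary_rule (.negM _ _) (ih _ List.mem_cons_self ρ Γ hΓ)
    | negM' Δ A => exact .unary_rule (.negM' _ _) (ih _ List.mem_cons_self ρ Γ hΓ)
    | conjM Δ A B => exact .unary_rule (.conjM _ _ _) (ih _ List.mem_cons_self ρ Γ hΓ)
    | conjM' Δ A B => exact .unary_rule (.conjM' _ _ _) (ih _ List.mem_cons_self ρ Γ hΓ)
    | disjM Δ A B => exact .unary_rule (.disjM _ _ _) (ih _ List.mem_cons_self ρ Γ hΓ)
    | disjM' Δ A B => exact .unary_rule (.disjM' _ _ _) (ih _ List.mem_cons_self ρ Γ hΓ)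
    | implM Δ A B => exact .unary_rule (.implM _ _ _) (ih _ List.mem_cons_self ρ Γ hΓ)
    | implM' Δ A B => exact .unary_rule (.implM' _ _ _) (ih _ List.mem_cons_self ρ Γ hΓ)
    | forallM Δ x A =>
      obtain ⟨y, hy, hy'⟩ := exists_fresh ρ Γ A
      have := ih _ List.mem_cons_self ρ Γ hΓ
      change Derivable ⟨Γ, neg ((forall_ x A).rename ρ)⟩ at this
      rw [rename_forall (y := y) fun z hz _ => hy' z hz] at this
      rw [rename_exists (y := y) (A := neg A) fun z hz _ => hy' z hz]
      exact .unary_rule (.forallM _ _ _) this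
    | forallM' Δ x A =>
      obtain ⟨y, hy, hy'⟩ := exists_fresh ρ Γ A
      have := ih _ List.mem_cons_self ρ Γ hΓ
      change Derivable ⟨Γ, neg ((forall_ x A).rename ρ)⟩
      rw [rename_exists (y := y) (A := neg A) fun z hz _ => hy' z hz] at this
      rw [rename_forall (y := y) fun z hz _ => hy' z hz]
      exact .unary_rule (.forallM' _ _ _) this
    | existsM Δ x A =>
      obtain ⟨y, hy, hy'⟩ := exists_fresh ρ Γ A
      have := ih _ List.mem_cons_self ρ Γ hΓ
      change Derivable ⟨Γ, neg ((exists_ x A).rename ρ)⟩ at this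
      rw [rename_exists (y := y) fun z hz _ => hy' z hz] at this
      rw [rename_forall (y := y) (A := neg A) fun z hz _ => hy' z hz]
      exact .unary_rule (.existsM _ _ _) this
    | existsM' Δ x A =>
      obtain ⟨y, hy, hy'⟩ := exists_fresh ρ Γ A
      have := ih _ List.mem_cons_self ρ Γ hΓ
      change Derivable ⟨Γ, neg ((exists_ x A).rename ρ)⟩
      rw [rename_forall (y := y) (A := neg A) fun z hz _ => hy' z hz] at this
      rw [rename_exists (y := y) fun z hz _ => hy' z hz]
      exact .unary_rule (.existsM' _ _ _) this

theorem Derivable.weaken {Γ Δ : Finset (Formula L)} {A : Formula L} (h : Derivable ⟨Γ, A⟩)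
    (hΓ : Γ ⊆ Δ) : Derivable ⟨Δ, A⟩ := by
  have := h.rename id Δ fun B hB => by rw [rename_id]; exact hΓ hB
  rwa [rename_id] at this

theorem Derivable.cut {Γ : Finset (Formula L)} {A B : Formula L} (h : Derivable ⟨Γ, A⟩)
    (h' : Derivable ⟨insert A Γ, B⟩) : Derivable ⟨Γ, B⟩ :=
  .binary_rule (.implE _ A _) (.unary_rule (.implI _ _ _) h') h

end Weakening

/-! ### Soundness -/

section Soundness

namespace TruthValue

@[simp] theorem neg_eq_ff {a : TruthValue} : a.neg = ff ↔ a = tt := by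
  cases a <;> simp [neg]

@[simp] theorem neg_eq_tt {a : TruthValue} : a.neg = tt ↔ a = ff := by
  cases a <;> simp [neg]

@[simp] theorem conj_eq_ff {a b : TruthValue} : a.conj b = ff ↔ a = ff ∨ b = ff := by
  cases a <;> cases b <;> simp [conj]

@[simp] theorem conj_eq_tt {a b : TruthValue} : a.conj b = tt ↔ a = tt ∧ b = tt := by
  cases a <;> cases b <;> simp [conj]

@[simp] theorem disj_eq_ff {a b : TruthValue} : a.disj b = ff ↔ a = ff ∧ b = ff := by
  cases a <;> cases b <;> simp [disj]

@[simp] theorem disj_eq_tt {a b : TruthValue} : a.disj b = tt ↔ a = tt ∨ b = tt := by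
  cases a <;> cases b <;> simp [disj]

@[simp] theorem impl_eq_ff {a b : TruthValue} : a.impl b = ff ↔ a ≠ ff ∧ b = ff := by
  cases a <;> cases b <;> simp [impl]

@[simp] theorem impl_eq_tt {a b : TruthValue} : a.impl b = tt ↔ a = ff ∨ b = tt := by
  cases a <;> cases b <;> simp [impl]

@[simp] theorem all_eq_tt {U : Type w} {a : U → TruthValue} : all a = tt ↔ ∀ d, a d = tt := by
  unfold all; split_ifs <;> simp_all

@[simp] theorem all_eq_ff {U : Type w} {a : U → TruthValue} : all a = ff ↔ ∃ d, a d = ff := by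
  unfold all
  split_ifs with h h' <;> simp_all

@[simp] theorem ex_eq_tt {U : Type w} {a : U → TruthValue} : ex a = tt ↔ ∃ d, a d = tt := by
  unfold ex; split_ifs <;> simp_all

@[simp] theorem ex_eq_ff {U : Type w} [Nonempty U] {a : U → TruthValue} :
    ex a = ff ↔ ∀ d, a d = ff := by
  unfold ex
  split_ifs with h h'
  · obtain ⟨d, hd⟩ := h
    simp only [false_iff, not_forall]
    exact ⟨d, by simp [hd]⟩
  · simp_all
  · simp_all

end TruthValue

theorem eval_inst (S : Struc.{u, v, w} L) (α : ℕ → S.U) (σ : ℕ → L.Term ℕ) {n : ℕ}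
    (A : PreFormula L n) (β : Fin n → S.U) :
    eval S α β (A.inst σ) = eval S (fun z => termVal S α (σ z)) β A := by
  have key : ∀ {n : ℕ} (β : Fin n → S.U),
      (fun z => termVal S (Sum.elim α β) (PreFormula.instVar σ z))
        = Sum.elim (fun z => termVal S α (σ z)) β := by
    intro n β
    funext z
    rcases z with z | i
    · simp [PreFormula.instVar, termVal_relabel, Function.comp_def]
    · simp [PreFormula.instVar, termVal]
  induction A with
  | falsum => rfl
  | pred P ts => simp only [PreFormula.inst, eval, termVal_subst, key]
  | equal t₁ t₂ => simp only [PreFormula.inst, eval, termVal_subst, key]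
  | neg A ih => simp only [PreFormula.inst, eval, ih]
  | conj A₁ A₂ ih₁ ih₂ => simp only [PreFormula.inst, eval, ih₁, ih₂]
  | disj A₁ A₂ ih₁ ih₂ => simp only [PreFormula.inst, eval, ih₁, ih₂]
  | impl A₁ A₂ ih₁ ih₂ => simp only [PreFormula.inst, eval, ih₁, ih₂]
  | all A ih => simp only [PreFormula.inst, eval, ih]
  | ex A ih => simp only [PreFormula.inst, eval, ih]

theorem interp_subst (S : Struc.{u, v, w} L) (α : ℕ → S.U) (x : ℕ) (t : L.Term ℕ)
    (A : Formula L) :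
    interp S α (A.subst x t) = interp S (Function.update α x (termVal S α t)) A := by
  rw [interp, interp, PreFormula.subst_eq_inst, eval_inst]
  congr 1
  funext z
  by_cases h : z = x
  · subst h; simp
  · simp [h, termVal]

theorem termVal_congr (S : Struc.{u, v, w} L) {n : ℕ} {e e' : ℕ ⊕ Fin n → S.U}
    (t : L.Term (ℕ ⊕ Fin n)) (h : ∀ z ∈ t.varFinsetLeft, e (Sum.inl z) = e' (Sum.inl z))
    (h' : ∀ i, e (Sum.inr i) = e' (Sum.inr i)) : termVal S e t = termVal S e' t := by
  induction t with
  | var x =>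
    rcases x with z | i
    · exact h z (by simp [Term.varFinsetLeft])
    · exact h' i
  | func F ts ih =>
    simp only [termVal]
    congr 1
    funext i
    exact ih i fun z hz => h z (by simpa [Term.varFinsetLeft] using ⟨i, hz⟩)

theorem eval_update_of_notMem (S : Struc.{u, v, w} L) {α : ℕ → S.U} {x : ℕ} (d : S.U) {n : ℕ}
    (A : PreFormula L n) (β : Fin n → S.U) (h : x ∉ A.free) :
    eval S (Function.update α x d) β A = eval S α β A := by
  have key : ∀ {n : ℕ} (β : Fin n → S.U) (t : L.Term (ℕ ⊕ Fin n)), x ∉ t.varFinsetLeft →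
      termVal S (Sum.elim (Function.update α x d) β) t = termVal S (Sum.elim α β) t := by
    intro n β t ht
    refine termVal_congr S t (fun z hz => ?_) fun _ => rfl
    have : z ≠ x := by rintro rfl; exact ht hz
    simp [this]
  induction A with
  | falsum => rfl
  | pred P ts =>
    simp only [eval]
    congr 1
    funext i
    exact key _ _ fun hi => h ⟨i, hi⟩
  | equal t₁ t₂ =>
    simp only [eval, key β t₁ fun hi => h (Or.inl hi), key β t₂ fun hi => h (Or.inr hi)]
  | neg A ih => simp only [eval, ih β h]
  | conj A₁ A₂ ih₁ ih₂ =>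
    simp only [eval, ih₁ β fun hi => h (Or.inl hi), ih₂ β fun hi => h (Or.inr hi)]
  | disj A₁ A₂ ih₁ ih₂ =>
    simp only [eval, ih₁ β fun hi => h (Or.inl hi), ih₂ β fun hi => h (Or.inr hi)]
  | impl A₁ A₂ ih₁ ih₂ =>
    simp only [eval, ih₁ β fun hi => h (Or.inl hi), ih₂ β fun hi => h (Or.inr hi)]
  | all A ih => simp only [eval, ih _ h]
  | ex A ih => simp only [eval, ih _ h]

theorem interp_eq (S : Struc.{u, v, w} L) (α : ℕ → S.U) (t₁ t₂ : L.Term ℕ) :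
    interp S α (Formula.eq t₁ t₂) = S.eq (termVal S α t₁) (termVal S α t₂) := by
  simp [interp, Formula.eq, eval, termVal_relabel, Function.comp_def]

/-- A designated equation is a true identity, even if its value is `both`; this is what makes
replacement of equals sound. -/
theorem Struc.eq_ne_ff (S : Struc.{u, v, w} L) {d d' : S.U} :
    S.eq d d' ≠ TruthValue.ff ↔ d = d' := by
  refine ⟨fun h => by_contra fun h' => h (S.eq_ne _ _ h'), ?_⟩
  rintro rfl
  rcases S.eq_self d with h | h <;> simp [h]

/-- Soundness of the proof system. -/
theorem Derivable.sound {s : Sequent L} (h : Derivable s) :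
    ∀ (S : Struc.{u, v, w} L) (α : ℕ → S.U),
      (∀ B ∈ s.left, interp S α B ≠ TruthValue.ff) → interp S α s.right ≠ TruthValue.ff := by
  induction h with
  | @rule ps s hr hp ih =>
    clear hp
    intro S α hΓ
    have := S.nonempty
    have hneg : ∀ A : Formula L, interp S α (.neg A) = (interp S α A).neg := fun _ => rfl
    have hconj : ∀ A B : Formula L,
      interp S α (.conj A B) = (interp S α A).conj (interp S α B) := fun _ _ => rfl
    have hdisj : ∀ A B : Formula L,
      interp S α (.disj A B) = (interp S α A).disj (interp S α B) := fun _ _ => rfl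
    have himpl : ∀ A B : Formula L,
      interp S α (.impl A B) = (interp S α A).impl (interp S α B) := fun _ _ => rfl
    have hfalse : interp S α (.falsum) = TruthValue.ff := rfl
    have hneg' : ∀ (β : ℕ → S.U) (A : Formula L),
      interp S β (.neg A) = (interp S β A).neg := fun _ _ => rfl
    cases hr with
    | ident Δ A => exact hΓ A (Finset.mem_insert_self _ _)
    | em Δ A =>
      simp only [hdisj, hneg, ne_eq, TruthValue.disj_eq_ff, TruthValue.neg_eq_ff]
      rintro ⟨h, h'⟩
      simp [h] at h'
    | disjE Δ A B C =>
      by_contra hC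
      have h₁ := ih ⟨Δ, .disj A B⟩ (by simp) S α hΓ
      have h₂ := ih ⟨insert A Δ, C⟩ (by simp) S α
      have h₃ := ih ⟨insert B Δ, C⟩ (by simp) S α
      simp only [Finset.forall_mem_insert] at h₂ h₃
      simp only [hdisj, ne_eq, TruthValue.disj_eq_ff] at h₁
      exact h₁ ⟨by_contra fun h => h₂ ⟨h, hΓ⟩ hC, by_contra fun h => h₃ ⟨h, hΓ⟩ hC⟩
    | implI Δ A B =>
      have h := ih ⟨insert A Δ, B⟩ (by simp) S α
      simp only [Finset.forall_mem_insert] at h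
      simp only [himpl, ne_eq, TruthValue.impl_eq_ff]
      exact fun hB => h ⟨hB.1, hΓ⟩ hB.2
    | forallI Δ x A hx =>
      simp only [interp_forall, ne_eq, TruthValue.all_eq_ff, not_exists]
      intro d
      refine ih ⟨Δ, A⟩ (by simp) S _ fun B hB => ?_
      rw [interp, eval_update_of_notMem S d B _ fun h => hx (Set.mem_biUnion hB h)]
      exact hΓ B hB
    | forallE Δ x t A =>
      have h := ih ⟨Δ, _⟩ List.mem_cons_self S α hΓ
      simp only [interp_forall, ne_eq, TruthValue.all_eq_ff, not_exists] at h
      simpa only [interp_subst] using h _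
    | existsI Δ x t A =>
      have h := ih ⟨Δ, _⟩ List.mem_cons_self S α hΓ
      simp only [interp_subst] at h
      simp only [interp_exists, ne_eq, TruthValue.ex_eq_ff]
      exact fun h' => h (h' _)
    | existsE Δ x A B hx =>
      have h := ih ⟨Δ, Formula.exists_ x A⟩ (by simp) S α hΓ
      simp only [interp_exists, ne_eq, TruthValue.ex_eq_ff, not_forall] at h
      obtain ⟨d, hd⟩ := h
      have h' := ih ⟨insert A Δ, B⟩ (by simp) S (Function.update α x d)
      simp only [Finset.forall_mem_insert] at h'
      have hx₂ : x ∉ B.free := fun h => hx (Set.mem_biUnion (x := B) (by simp) h)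
      specialize h' ⟨hd, fun C hC => ?_⟩
      · rw [interp, eval_update_of_notMem S d C _ fun h =>
          hx (Set.mem_biUnion (x := C) (by simp [hC]) h)]
        exact hΓ C hC
      · rwa [interp, eval_update_of_notMem S d B _ hx₂] at h'
    | eqI Δ t =>
      simp only [interp_eq]
      exact S.eq_ne_ff.2 rfl
    | eqE Δ x t₁ t₂ A =>
      have h₁ := ih ⟨Δ, Formula.eq t₁ t₂⟩ (by simp) S α hΓ
      have h₂ := ih ⟨Δ, A.subst x t₁⟩ (by simp) S α hΓ
      simp only [interp_eq] at h₁
      simp only [interp_subst] at h₂ ⊢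
      rwa [← S.eq_ne_ff.1 h₁]
    -- The remaining rules follow from the conditions under which each connective or quantifier
    -- takes the value `ff` or `tt`.
    | _ =>
      replace ih := fun p hp => ih p hp S α
      simp only [List.mem_cons, List.not_mem_nil, or_false, forall_eq_or_imp, forall_eq] at ih
      simp_all [interp_forall, interp_exists]

end Soundness

/-! ### Saturated sets -/

section Saturation

open PreFormula Formula

/-- A deductively closed set of formulas without `C` that has the disjunction property and contains
a witness for each of its existential formulas. -/
structure Saturated (Δ : Set (Formula L)) (C : Formula L) : Prop where
  closed {Γ : Finset (Formula L)} {A : Formula L} :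
    ↑Γ ⊆ Δ → Derivable ⟨Γ, A⟩ → A ∈ Δ
  notMem : C ∉ Δ
  prime {A B : Formula L} : disj A B ∈ Δ → A ∈ Δ ∨ B ∈ Δ
  witness {x : ℕ} {A : Formula L} : exists_ x A ∈ Δ → ∃ t : L.Term ℕ, A.subst x t ∈ Δ

/-- One stage of the Henkin construction. `A` is added if `C` stays underivable; then, if `exists_ x
A` could be added too, its instance at a fresh variable is added. Finiteness of `Γ` guarantees such
a variable. -/
theorem exists_extension {C : Formula L} {Γ : Finset (Formula L)} (h : ¬ Derivable ⟨Γ, C⟩)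
    (x : ℕ) (A : Formula L) :
    ∃ Γ', Γ ⊆ Γ' ∧ ¬ Derivable ⟨Γ', C⟩ ∧ (A ∈ Γ' ∨ Derivable ⟨insert A Γ', C⟩) ∧
      ((∃ t : L.Term ℕ, A.subst x t ∈ Γ') ∨ Derivable ⟨insert (exists_ x A) Γ', C⟩) := by
  obtain ⟨Γ₁, hΓ, h₁, hA⟩ : ∃ Γ', Γ ⊆ Γ' ∧ ¬ Derivable ⟨Γ', C⟩ ∧
      (A ∈ Γ' ∨ Derivable ⟨insert A Γ', C⟩) := by
    by_cases hA : Derivable ⟨insert A Γ, C⟩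
    · exact ⟨Γ, subset_rfl, h, Or.inr hA⟩
    · exact ⟨_, Finset.subset_insert _ _, hA, Or.inl (Finset.mem_insert_self _ _)⟩
  by_cases hE : Derivable ⟨insert (exists_ x A) Γ₁, C⟩
  · exact ⟨Γ₁, hΓ, h₁, hA, Or.inr hE⟩
  obtain ⟨y, hy, hyA⟩ := exists_fresh id (insert (exists_ x A) Γ₁ ∪ {C}) A
  have hyA : y ∉ A.free := fun hy => hyA y hy rfl
  refine ⟨insert (A.subst x (Term.var y)) Γ₁, hΓ.trans (Finset.subset_insert _ _),
    fun hC => hE ?_, ?_, Or.inl ⟨_, Finset.mem_insert_self _ _⟩⟩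
  -- If the fresh instance yielded `C`, existential elimination would already yield `C` from
  -- `exists_ x A`, against `hE`.
  · refine .binary_rule (.existsE _ y (A.subst x (Term.var y)) _ hy) ?_
      (hC.weaken (Finset.insert_subset_insert _ (Finset.subset_insert _ _)))
    rw [show exists_ y (A.subst x (Term.var y)) = exists_ x A from
      congrArg ex (close_subst_var x y A hyA)]
    exact .of_mem (Finset.mem_insert_self _ _)
  · exact hA.imp Finset.mem_insert_of_mem
      fun hA => hA.weaken (Finset.insert_subset_insert _ (Finset.subset_insert _ _))

theorem exists_saturated [∀ n, Countable (L.Functions n)] [∀ n, Countable (L.Relations n)]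
    {C : Formula L} {Γ : Finset (Formula L)} (h : ¬ Derivable ⟨Γ, C⟩) :
    ∃ Δ : Set (Formula L), ↑Γ ⊆ Δ ∧ Saturated Δ C := by
  have : Countable (Formula L) := PreFormula.countable 0
  have : Nonempty (ℕ × Formula L) := ⟨(0, falsum)⟩
  obtain ⟨e, he⟩ := exists_surjective_nat (ℕ × Formula L)
  choose step hsub hnot hdec hwit using
    fun (Γ : {Γ : Finset (Formula L) // ¬ Derivable ⟨Γ, C⟩}) (a : ℕ × Formula L) =>
      exists_extension Γ.2 a.1 a.2
  -- Every pair of a variable and a formula is treated at some stage; `Δ` will be the union of the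
  -- stages.
  let seq : ℕ → {Γ : Finset (Formula L) // ¬ Derivable ⟨Γ, C⟩} :=
    fun k => Nat.rec ⟨Γ, h⟩ (fun k Γ => ⟨step Γ (e k), hnot Γ (e k)⟩) k
  have mono : Monotone fun k => (seq k).1 := monotone_nat_of_le_succ fun k => hsub (seq k) (e k)
  let Δ : Set (Formula L) := {A | ∃ k, A ∈ (seq k).1}
  have bound : ∀ Γ : Finset (Formula L), ↑Γ ⊆ Δ → ∃ k, Γ ⊆ (seq k).1 := by
    intro Γ
    induction Γ using Finset.induction_on with
    | empty => exact fun _ => ⟨0, Finset.empty_subset _⟩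
    | insert A Γ _ ih =>
      intro hΓ
      rw [Finset.coe_insert, Set.insert_subset_iff] at hΓ
      obtain ⟨k, hk⟩ := ih hΓ.2
      obtain ⟨j, hj⟩ := hΓ.1
      exact ⟨max j k, Finset.insert_subset (mono (le_max_left j k) hj)
        (hk.trans (mono (le_max_right j k)))⟩
  -- A formula outside `Δ` was rejected at its own stage, so together with any later stage it yields
  -- `C`. Closure and primeness both reduce to this.
  have dec : ∀ A ∉ Δ, ∃ k, ∀ j ≥ k, Derivable ⟨insert A (seq j).1, C⟩ := by
    intro A hA
    -- The variable `0` is arbitrary: only the decision on `A` at this stage is used.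
    obtain ⟨k, hk⟩ := he (0, A)
    refine ⟨k + 1, fun j hj => ?_⟩
    have := hdec (seq k) (e k)
    rw [hk] at this
    refine (this.resolve_left fun h => hA ⟨k + 1, ?_⟩).weaken
      (Finset.insert_subset_insert _ ((Finset.Subset.trans ?_ (mono hj))))
    · simpa only [seq, hk] using h
    · simp only [seq, hk]; exact subset_rfl
  have closed : ∀ {Γ : Finset (Formula L)} {A : Formula L},
      ↑Γ ⊆ Δ → Derivable ⟨Γ, A⟩ → A ∈ Δ := by
    intro Γ A hΓ hd
    by_contra hA
    obtain ⟨k, hk⟩ := bound Γ hΓ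
    obtain ⟨j, hj⟩ := dec A hA
    exact (seq (max j k)).2 ((hd.weaken (hk.trans (mono (le_max_right j k)))).cut
      (hj _ (le_max_left j k)))
  refine ⟨Δ, fun A hA => ⟨0, hA⟩, closed, ?_, ?_, ?_⟩
  · rintro ⟨k, hk⟩
    exact (seq k).2 (.of_mem hk)
  · rintro A B ⟨k, hk⟩
    by_contra! hAB
    obtain ⟨i, hi⟩ := dec A hAB.1
    obtain ⟨j, hj⟩ := dec B hAB.2
    exact (seq (max k (max i j))).2 (.ternary_rule (.disjE _ A B _)
      (.of_mem (mono (le_max_left k _) hk))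
      (hi _ (by omega)) (hj _ (by omega)))
  · rintro x A ⟨k, hk⟩
    obtain ⟨j, hj⟩ := he (x, A)
    have := hwit (seq j) (e j)
    rcases this with ⟨t, ht⟩ | hd
    · rw [hj] at ht
      exact ⟨t, j + 1, by simpa only [seq, hj] using ht⟩
    · rw [hj] at hd
      -- If no witness was added, `exists_ x A` yields `C` with a later stage that already contains
      -- it, and a cut contradicts underivability of `C`.
      refine ((seq (max k (j + 1))).2 (Derivable.cut
        (.of_mem (mono (le_max_left k _) hk)) (hd.weaken
        (Finset.insert_subset_insert _ ((Finset.Subset.trans ?_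
          (mono (le_max_right k (j + 1))))))))).elim
      simp only [seq, hj]
      exact subset_rfl

namespace Saturated

variable {Δ : Set (Formula L)} {C : Formula L}

theorem nullary (hΔ : Saturated Δ C) {A : Formula L} (hr : Rule [] ⟨∅, A⟩) : A ∈ Δ :=
  hΔ.closed (Γ := ∅) (by simp) (.nullary_rule hr)

theorem unary (hΔ : Saturated Δ C) {A B : Formula L} (hr : Rule [⟨{A}, A⟩] ⟨{A}, B⟩)
    (h : A ∈ Δ) : B ∈ Δ :=
  hΔ.closed (Γ := {A}) (by simpa using h) (.unary_rule hr (.of_mem (by simp)))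

theorem binary (hΔ : Saturated Δ C) {A₁ A₂ B : Formula L}
    (hr : Rule [⟨{A₁, A₂}, A₁⟩, ⟨{A₁, A₂}, A₂⟩] ⟨{A₁, A₂}, B⟩) (h₁ : A₁ ∈ Δ) (h₂ : A₂ ∈ Δ) :
    B ∈ Δ :=
  hΔ.closed (Γ := {A₁, A₂}) (by simp [Set.insert_subset_iff, h₁, h₂])
    (.binary_rule hr (.of_mem (by simp)) (.of_mem (by simp)))

theorem mem_or_neg_mem (hΔ : Saturated Δ C) (A : Formula L) : A ∈ Δ ∨ neg A ∈ Δ :=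
  hΔ.prime (hΔ.nullary (.em _ _))

theorem falsum_notMem (hΔ : Saturated Δ C) : falsum ∉ Δ :=
  fun h => hΔ.notMem (hΔ.unary (.falseE _ _) h)

theorem neg_neg_mem (hΔ : Saturated Δ C) {A : Formula L} : neg (neg A) ∈ Δ ↔ A ∈ Δ :=
  ⟨hΔ.unary (.negM _ _), hΔ.unary (.negM' _ _)⟩

theorem conj_mem (hΔ : Saturated Δ C) {A B : Formula L} : conj A B ∈ Δ ↔ A ∈ Δ ∧ B ∈ Δ :=
  ⟨fun h => ⟨hΔ.unary (.conjE₁ _ _ B) h, hΔ.unary (.conjE₂ _ A _) h⟩,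
    fun h => hΔ.binary (.conjI _ _ _) h.1 h.2⟩

theorem disj_mem (hΔ : Saturated Δ C) {A B : Formula L} : disj A B ∈ Δ ↔ A ∈ Δ ∨ B ∈ Δ :=
  ⟨hΔ.prime, fun h => h.elim (hΔ.unary (.disjI₁ _ _ _)) (hΔ.unary (.disjI₂ _ _ _))⟩

theorem neg_conj_mem (hΔ : Saturated Δ C) {A B : Formula L} :
    neg (conj A B) ∈ Δ ↔ neg A ∈ Δ ∨ neg B ∈ Δ := by
  rw [← hΔ.disj_mem]
  exact ⟨hΔ.unary (.conjM _ _ _), hΔ.unary (.conjM' _ _ _)⟩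

theorem neg_disj_mem (hΔ : Saturated Δ C) {A B : Formula L} :
    neg (disj A B) ∈ Δ ↔ neg A ∈ Δ ∧ neg B ∈ Δ := by
  rw [← hΔ.conj_mem]
  exact ⟨hΔ.unary (.disjM _ _ _), hΔ.unary (.disjM' _ _ _)⟩

theorem neg_impl_mem (hΔ : Saturated Δ C) {A B : Formula L} :
    neg (impl A B) ∈ Δ ↔ A ∈ Δ ∧ neg B ∈ Δ := by
  rw [← hΔ.conj_mem]
  exact ⟨hΔ.unary (.implM _ _ _), hΔ.unary (.implM' _ _ _)⟩

/-- For the converse, if `A → B` is missing then its negation is present and supplies `A`; the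
assumption then gives `B`, from which `A → B` is derivable. -/
theorem impl_mem (hΔ : Saturated Δ C) {A B : Formula L} :
    impl A B ∈ Δ ↔ (A ∈ Δ → B ∈ Δ) := by
  refine ⟨fun h h' => hΔ.binary (.implE _ A _) h h', fun h => ?_⟩
  rcases hΔ.mem_or_neg_mem (impl A B) with h' | h'
  · exact h'
  · exact hΔ.closed (Γ := {B}) (by simpa using h (hΔ.neg_impl_mem.1 h').1)
      (.unary_rule (.implI _ _ _) (.of_mem (by simp)))

theorem exists_mem (hΔ : Saturated Δ C) {x : ℕ} {A : Formula L} :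
    exists_ x A ∈ Δ ↔ ∃ t : L.Term ℕ, A.subst x t ∈ Δ :=
  ⟨hΔ.witness, fun ⟨_, ht⟩ => hΔ.unary (.existsI _ _ _ _) ht⟩

/-- The nontrivial direction uses a witness of the formula `∃ x, (A → ∀ x, A)`. -/
theorem forall_mem (hΔ : Saturated Δ C) {x : ℕ} {A : Formula L} :
    forall_ x A ∈ Δ ↔ ∀ t : L.Term ℕ, A.subst x t ∈ Δ := by
  refine ⟨fun h t => hΔ.unary (.forallE _ _ _ _) h, fun h => ?_⟩
  have hx : x ∉ (forall_ x A).free := notMem_free_close x A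
  -- A witness `¬A(t)` of `¬∀x A` would not help, since `Δ` may contain both `A(t)` and `¬A(t)`. In
  -- the first case below, a witness gives `A(t) → ∀x A`, and modus ponens applies. In the second,
  -- `∀x ¬(A → ∀x A)` yields `A` for the variable `x` itself, and generalising over `x` is allowed
  -- since `x` is not free in that premise.
  rcases hΔ.mem_or_neg_mem (exists_ x (impl A (forall_ x A))) with h' | h'
  · obtain ⟨t, ht⟩ := hΔ.witness h'
    rw [PreFormula.subst, subst_of_notMem_free _ _ _ hx] at ht
    exact hΔ.impl_mem.1 ht (h t)
  · replace h' := hΔ.unary (.existsM _ _ _) h'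
    refine hΔ.closed (Γ := {forall_ x (neg (impl A (forall_ x A)))}) (by simpa using h')
      (.unary_rule (.forallI _ _ _ ?_) (.unary_rule (.conjE₁ _ _ (neg (forall_ x A)))
      (.unary_rule (.implM _ _ _) ?_)))
    · simp only [freeVars, Finset.mem_singleton, Set.iUnion_iUnion_eq_left]
      exact notMem_free_close x (neg (impl A (forall_ x A)))
    · have := Derivable.unary_rule (.forallE {forall_ x (neg (impl A (forall_ x A)))} x
        (Term.var x) _) (.of_mem (Finset.mem_singleton_self _))
      rwa [subst_var_self] at this

theorem neg_forall_mem (hΔ : Saturated Δ C) {x : ℕ} {A : Formula L} :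
    neg (forall_ x A) ∈ Δ ↔ ∃ t : L.Term ℕ, neg (A.subst x t) ∈ Δ :=
  Iff.trans ⟨hΔ.unary (.forallM _ _ _), hΔ.unary (.forallM' _ _ _)⟩ hΔ.exists_mem

theorem neg_exists_mem (hΔ : Saturated Δ C) {x : ℕ} {A : Formula L} :
    neg (exists_ x A) ∈ Δ ↔ ∀ t : L.Term ℕ, neg (A.subst x t) ∈ Δ :=
  Iff.trans ⟨hΔ.unary (.existsM _ _ _), hΔ.unary (.existsM' _ _ _)⟩ hΔ.forall_mem

end Saturated

end Saturation

/-! ### Equations in a saturated set form a congruence -/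

section Congruence

open PreFormula Formula

theorem exists_term_subst_update_eq (t : L.Term ℕ) :
    ∃ N, ∀ x ≥ N, ∀ u, t.subst (Function.update Term.var x u) = t := by
  induction t with
  | var y =>
    refine ⟨y + 1, fun x hx u => ?_⟩
    simp [Term.subst, show y ≠ x by omega]
  | func f ts ih =>
    choose N hN using ih
    refine ⟨Finset.univ.sup N, fun x hx u => ?_⟩
    simp only [Term.subst, Term.func.injEq, heq_eq_eq, true_and]
    funext i
    exact hN i x ((Finset.le_sup (Finset.mem_univ i)).trans hx) u

/-- Provides a placeholder variable marking the one argument position where an equation is to be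
applied. -/
theorem exists_fresh_of_terms {k : ℕ} (ts : Fin k → L.Term ℕ) :
    ∃ x, ∀ i u, (ts i).subst (Function.update Term.var x u) = ts i := by
  choose N hN using fun i => exists_term_subst_update_eq (ts i)
  exact ⟨Finset.univ.sup N, fun i u => hN i _ (Finset.le_sup (Finset.mem_univ i)) u⟩

/-- A property of tuples that allows the replacement of one entry by a related one allows the
replacement of all. -/
theorem of_forall_update {k : ℕ} {α : Type*} {R : α → α → Prop} {φ : (Fin k → α) → Prop}
    (h : ∀ ts i s, R (ts i) s → φ ts → φ (Function.update ts i s)) {ts ss : Fin k → α}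
    (hR : ∀ i, R (ts i) (ss i)) (hφ : φ ts) : φ ss := by
  have key : ∀ J : Finset (Fin k), φ (J.piecewise ss ts) := by
    intro J
    induction J using Finset.induction_on with
    | empty => simpa using hφ
    | insert i J hi ih =>
      rw [Finset.piecewise_insert]
      refine h _ _ _ ?_ ih
      rw [Finset.piecewise_eq_of_notMem _ _ _ hi]
      exact hR i
  simpa using key Finset.univ

/-- The formula `P(t₁, …, tₖ)`. -/
def atom {k : ℕ} (P : L.Relations k) (ts : Fin k → L.Term ℕ) : Formula L :=
  pred P fun i => (ts i).relabel Sum.inl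

theorem relabel_inl_subst_instVar (σ : ℕ → L.Term ℕ) {n : ℕ} (t : L.Term ℕ) :
    (t.relabel (Sum.inl : ℕ → ℕ ⊕ Fin n)).subst (instVar σ) = (t.subst σ).relabel Sum.inl := by
  simp only [term_relabel_eq_subst, term_subst_subst, Term.subst, instVar]

theorem atom_subst {k : ℕ} (P : L.Relations k) (ts : Fin k → L.Term ℕ) (x : ℕ) (t : L.Term ℕ) :
    (atom P ts).subst x t = atom P fun i => (ts i).subst (Function.update Term.var x t) := by
  simp only [subst_eq_inst, atom, inst, relabel_inl_subst_instVar]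

theorem eq_subst (s₁ s₂ : L.Term ℕ) (x : ℕ) (t : L.Term ℕ) :
    (Formula.eq s₁ s₂).subst x t = Formula.eq (s₁.subst (Function.update Term.var x t))
      (s₂.subst (Function.update Term.var x t)) := by
  simp only [subst_eq_inst, Formula.eq, inst, relabel_inl_subst_instVar]

theorem relabel_inl_surjective (t : L.Term (ℕ ⊕ Fin 0)) :
    ∃ s : L.Term ℕ, s.relabel Sum.inl = t := by
  refine ⟨t.relabel (Sum.elim id Fin.elim0), ?_⟩
  conv_rhs => rw [← term_subst_var t]
  rw [term_relabel_eq_subst, term_relabel_eq_subst, term_subst_subst]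
  exact term_subst_congr _ (fun _ _ => rfl) fun i => i.elim0

theorem update_subst_update {k : ℕ} {ts : Fin k → L.Term ℕ} {x : ℕ}
    (hx : ∀ i u, (ts i).subst (Function.update Term.var x u) = ts i) (i : Fin k)
    (s : L.Term ℕ) :
    (fun j => (Function.update ts i (Term.var x) j).subst (Function.update Term.var x s))
      = Function.update ts i s := by
  funext j
  by_cases h : j = i
  · subst h; simp [Term.subst]
  · simp [h, hx]

namespace Saturated

variable {Δ : Set (Formula L)} {C : Formula L}

theorem eq_refl_mem (hΔ : Saturated Δ C) (t : L.Term ℕ) : Formula.eq t t ∈ Δ :=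
  hΔ.nullary (.eqI _ _)

theorem subst_mem (hΔ : Saturated Δ C) {t s : L.Term ℕ} (h : Formula.eq t s ∈ Δ) {x : ℕ}
    {A : Formula L} (hA : A.subst x t ∈ Δ) : A.subst x s ∈ Δ :=
  hΔ.binary (.eqE _ _ _ _ _) h hA

/-- Replacement of `t` by `s` in the formula `x = t`, with `x` not occurring in `t`, turns `t = t`
into `s = t`. -/
theorem eq_symm_mem (hΔ : Saturated Δ C) {t s : L.Term ℕ} (h : Formula.eq t s ∈ Δ) :
    Formula.eq s t ∈ Δ := by
  obtain ⟨x, hx⟩ := exists_term_subst_update_eq t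
  have := hΔ.subst_mem h (x := x) (A := Formula.eq (Term.var x) t)
  simp only [eq_subst, hx x le_rfl, Term.subst, Function.update_self] at this
  exact this (hΔ.eq_refl_mem t)

theorem eq_trans_mem (hΔ : Saturated Δ C) {t s r : L.Term ℕ} (h : Formula.eq t s ∈ Δ)
    (h' : Formula.eq s r ∈ Δ) : Formula.eq t r ∈ Δ := by
  obtain ⟨x, hx⟩ := exists_term_subst_update_eq t
  have := hΔ.subst_mem h' (x := x) (A := Formula.eq t (Term.var x))
  simp only [eq_subst, hx x le_rfl, Term.subst, Function.update_self] at this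
  exact this h

theorem atom_mem (hΔ : Saturated Δ C) {k : ℕ} {P : L.Relations k} {ts ss : Fin k → L.Term ℕ}
    (h : ∀ i, Formula.eq (ts i) (ss i) ∈ Δ) (hP : atom P ts ∈ Δ) : atom P ss ∈ Δ := by
  refine of_forall_update (R := fun t s => Formula.eq t s ∈ Δ)
    (φ := fun ts => atom P ts ∈ Δ) (fun ts i s hi hts => ?_) h hP
  obtain ⟨x, hx⟩ := exists_fresh_of_terms ts
  have := hΔ.subst_mem hi (x := x) (A := atom P (Function.update ts i (Term.var x)))
  simp only [atom_subst, update_subst_update hx, Function.update_eq_self] at this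
  exact this hts

/-- Not a consequence of `atom_mem`: an atom and its negation may both lie in `Δ`, so congruence
must be proved for each. -/
theorem neg_atom_mem (hΔ : Saturated Δ C) {k : ℕ} {P : L.Relations k}
    {ts ss : Fin k → L.Term ℕ} (h : ∀ i, Formula.eq (ts i) (ss i) ∈ Δ)
    (hP : neg (atom P ts) ∈ Δ) : neg (atom P ss) ∈ Δ := by
  refine of_forall_update (R := fun t s => Formula.eq t s ∈ Δ)
    (φ := fun ts => neg (atom P ts) ∈ Δ) (fun ts i s hi hts => ?_) h hP
  obtain ⟨x, hx⟩ := exists_fresh_of_terms ts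
  have := hΔ.subst_mem hi (x := x) (A := neg (atom P (Function.update ts i (Term.var x))))
  simp only [PreFormula.subst, atom_subst, update_subst_update hx,
    Function.update_eq_self] at this
  exact this hts

theorem func_eq_mem (hΔ : Saturated Δ C) {k : ℕ} {f : L.Functions k} {ts ss : Fin k → L.Term ℕ}
    (h : ∀ i, Formula.eq (ts i) (ss i) ∈ Δ) :
    Formula.eq (Term.func f ts) (Term.func f ss) ∈ Δ := by
  -- The left side stays fixed while arguments on the right are replaced one by one; transitivity
  -- links the steps.
  refine of_forall_update (R := fun t s => Formula.eq t s ∈ Δ)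
    (φ := fun rs => Formula.eq (Term.func f ts) (Term.func f rs) ∈ Δ)
    (fun rs i s hi hrs => hΔ.eq_trans_mem hrs ?_) h (hΔ.eq_refl_mem _)
  obtain ⟨x, hx⟩ := exists_fresh_of_terms rs
  have := hΔ.subst_mem hi (x := x)
    (A := Formula.eq (Term.func f rs) (Term.func f (Function.update rs i (Term.var x))))
  simp only [eq_subst, Term.subst, update_subst_update hx, Function.update_eq_self, hx] at this
  exact this (hΔ.eq_refl_mem _)

theorem neg_eq_mem (hΔ : Saturated Δ C) {t₁ t₂ s₁ s₂ : L.Term ℕ}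
    (h₁ : Formula.eq t₁ s₁ ∈ Δ) (h₂ : Formula.eq t₂ s₂ ∈ Δ)
    (h : neg (Formula.eq t₁ t₂) ∈ Δ) : neg (Formula.eq s₁ s₂) ∈ Δ := by
  obtain ⟨x, hx⟩ := exists_term_subst_update_eq t₂
  obtain ⟨y, hy⟩ := exists_term_subst_update_eq s₁
  have h₃ := hΔ.subst_mem h₁ (x := x) (A := neg (Formula.eq (Term.var x) t₂))
  have h₄ := hΔ.subst_mem h₂ (x := y) (A := neg (Formula.eq s₁ (Term.var y)))
  simp only [PreFormula.subst, eq_subst, hx x le_rfl, hy y le_rfl, Term.subst,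
    Function.update_self] at h₃ h₄
  exact h₄ (h₃ h)

/-- Terms are identified if their equation is in `Δ`. -/
def termSetoid (hΔ : Saturated Δ C) : Setoid (L.Term ℕ) where
  r t s := Formula.eq t s ∈ Δ
  iseqv := ⟨hΔ.eq_refl_mem, hΔ.eq_symm_mem, hΔ.eq_trans_mem⟩

end Saturated

end Congruence

/-! ### The term model and the truth lemma -/

section TermModel

open PreFormula Formula

open Classical in
/-- The truth value that `Δ` ascribes to a formula. -/
noncomputable def ascribed (Δ : Set (Formula L)) (A : Formula L) : TruthValue :=
  if A ∉ Δ then TruthValue.ff else if neg A ∉ Δ then TruthValue.tt else TruthValue.both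

namespace Saturated

variable {Δ : Set (Formula L)} {C : Formula L}

theorem ascribed_ne_ff (_hΔ : Saturated Δ C) {A : Formula L} :
    ascribed Δ A ≠ TruthValue.ff ↔ A ∈ Δ := by
  unfold ascribed
  split_ifs <;> simp_all

/-- The case `A ∉ Δ` needs completeness for negation: the value is then `ff`, and `neg A` must lie
in `Δ`. -/
theorem ascribed_ne_tt (hΔ : Saturated Δ C) {A : Formula L} :
    ascribed Δ A ≠ TruthValue.tt ↔ neg A ∈ Δ := by
  have := hΔ.mem_or_neg_mem A
  unfold ascribed
  split_ifs <;> simp_all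

/-- The class of a term. -/
def cls (hΔ : Saturated Δ C) (t : L.Term ℕ) : ULift.{w} (Quotient hΔ.termSetoid) :=
  ⟨Quotient.mk _ t⟩

/-- A representative of a class of terms. -/
noncomputable def rep (hΔ : Saturated Δ C) (d : ULift.{w} (Quotient hΔ.termSetoid)) : L.Term ℕ :=
  d.down.out

theorem cls_rep (hΔ : Saturated Δ C) (d : ULift.{w} (Quotient hΔ.termSetoid)) :
    hΔ.cls (hΔ.rep d) = d :=
  ULift.ext _ _ (Quotient.out_eq d.down)

theorem cls_eq_cls (hΔ : Saturated Δ C) {t s : L.Term ℕ} :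
    cls.{u, v, w} hΔ t = cls.{u, v, w} hΔ s ↔ Formula.eq t s ∈ Δ := by
  rw [cls, cls, ULift.up_inj, Quotient.eq]
  rfl

theorem eq_rep_cls_mem (hΔ : Saturated Δ C) (t : L.Term ℕ) :
    Formula.eq t (hΔ.rep (cls.{u, v, w} hΔ t)) ∈ Δ := by
  rw [← cls_eq_cls.{u, v, w} hΔ, cls_rep]

/-- The structure of terms modulo the equations in `Δ`. -/
noncomputable def termModel (hΔ : Saturated Δ C) : Struc.{u, v, max u w} L where
  -- The lift lets the domain lie in any prescribed universe when the signature lies in the lowest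
  -- one.
  U := ULift.{w} (Quotient hΔ.termSetoid)
  nonempty := ⟨hΔ.cls (Term.var 0)⟩
  func f ds := hΔ.cls (Term.func f fun i => hΔ.rep (ds i))
  pred P ds := ascribed Δ (atom P fun i => hΔ.rep (ds i))
  eq d d' := ascribed Δ (Formula.eq (hΔ.rep d) (hΔ.rep d'))
  eq_self d := by
    have := hΔ.ascribed_ne_ff.2 (hΔ.eq_refl_mem (hΔ.rep d))
    generalize ascribed Δ _ = a at *
    cases a <;> simp_all
  eq_ne d d' h := by
    by_contra hne
    apply h
    rw [← hΔ.cls_rep d, ← hΔ.cls_rep d', hΔ.cls_eq_cls]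
    exact hΔ.ascribed_ne_ff.1 hne

/-- The assignment of its own class to each variable. -/
def canonical (hΔ : Saturated Δ C) : ℕ → (termModel.{u, v, w} hΔ).U :=
  fun x => hΔ.cls (Term.var x)

theorem termVal_canonical (hΔ : Saturated Δ C) (t : L.Term ℕ) :
    termVal (termModel.{u, v, w} hΔ) hΔ.canonical t = hΔ.cls t := by
  induction t with
  | var x => rfl
  | func f ts ih =>
    simp only [termVal, ih]
    exact hΔ.cls_eq_cls.2 (hΔ.func_eq_mem fun i => hΔ.eq_symm_mem (hΔ.eq_rep_cls_mem _))

theorem interp_update_canonical (hΔ : Saturated Δ C) (x : ℕ) (t : L.Term ℕ) (A : Formula L) :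
    interp (termModel.{u, v, w} hΔ) (Function.update hΔ.canonical x (hΔ.cls t)) A
      = interp (termModel.{u, v, w} hΔ) hΔ.canonical (A.subst x t) := by
  rw [interp_subst, termVal_canonical]

/-- Every element of the domain is the class of a term, so quantification over the domain amounts to
quantification over substitution instances. -/
theorem forall_interp_update (hΔ : Saturated Δ C) (x : ℕ) (A : Formula L)
    (p : TruthValue → Prop) :
    (∀ d, p (interp (termModel.{u, v, w} hΔ) (Function.update hΔ.canonical x d) A)) ↔
      ∀ t, p (interp (termModel.{u, v, w} hΔ) hΔ.canonical (A.subst x t)) := by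
  refine ⟨fun h t => hΔ.interp_update_canonical x t A ▸ h _, fun h d => ?_⟩
  rw [← hΔ.cls_rep d, hΔ.interp_update_canonical]
  exact h _

theorem exists_interp_update (hΔ : Saturated Δ C) (x : ℕ) (A : Formula L)
    (p : TruthValue → Prop) :
    (∃ d, p (interp (termModel.{u, v, w} hΔ) (Function.update hΔ.canonical x d) A)) ↔
      ∃ t, p (interp (termModel.{u, v, w} hΔ) hΔ.canonical (A.subst x t)) := by
  simpa only [not_forall, not_not] using not_congr (hΔ.forall_interp_update x A fun a => ¬ p a)

theorem exists_eq_close (B : PreFormula L 1) :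
    ∃ (x : ℕ) (A : Formula L), B = A.close x := by
  obtain ⟨x, hx⟩ := B.finite_free.exists_notMem
  obtain ⟨A, hA⟩ := exists_close_eq x B hx rfl
  exact ⟨x, A, hA.symm⟩

/-- The term model makes true the formulas in `Δ`, and makes false those with negation in `Δ`. -/
theorem truth (hΔ : Saturated Δ C) (A : Formula L) :
    (interp (termModel.{u, v, w} hΔ) hΔ.canonical A ≠ TruthValue.ff ↔ A ∈ Δ) ∧
      (interp (termModel.{u, v, w} hΔ) hΔ.canonical A ≠ TruthValue.tt ↔ neg A ∈ Δ) := by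
  -- Instances `A.subst x t` are not subformulas, but have the size of `A`. The two equivalences are
  -- proved together because negation interchanges them.
  induction hn : A.size using Nat.strong_induction_on generalizing A with
  | _ n ih =>
  subst hn
  have := (termModel.{u, v, w} hΔ).nonempty
  cases A with
  | falsum =>
    simp only [interp, eval, ne_eq, not_true_eq_false, hΔ.falsum_notMem,
      not_false_eq_true, reduceCtorEq, true_and, true_iff]
    exact hΔ.nullary (.trueI _)
  | pred P ts =>
    choose ss hs using fun i => relabel_inl_surjective (ts i)
    obtain rfl : ts = fun i => (ss i).relabel Sum.inl := funext fun i => (hs i).symm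
    have hv : interp (termModel.{u, v, w} hΔ) hΔ.canonical (atom P ss)
        = ascribed Δ (atom P fun i => hΔ.rep (cls.{u, v, w} hΔ (ss i))) := by
      simp only [interp, atom, eval, termVal_relabel, Sum.elim_comp_inl, termVal_canonical]
      rfl
    change (interp _ _ (atom P ss) ≠ _ ↔ atom P ss ∈ Δ) ∧
      (interp _ _ (atom P ss) ≠ _ ↔ neg (atom P ss) ∈ Δ)
    -- The model evaluates the atom at chosen representatives; congruence carries membership, of the
    -- atom and of its negation, back to the given terms.
    rw [hv, hΔ.ascribed_ne_ff, hΔ.ascribed_ne_tt]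
    exact ⟨⟨hΔ.atom_mem fun i => hΔ.eq_symm_mem (hΔ.eq_rep_cls_mem _),
      hΔ.atom_mem fun i => hΔ.eq_rep_cls_mem _⟩,
      ⟨hΔ.neg_atom_mem fun i => hΔ.eq_symm_mem (hΔ.eq_rep_cls_mem _),
      hΔ.neg_atom_mem fun i => hΔ.eq_rep_cls_mem _⟩⟩
  | equal t₁ t₂ =>
    obtain ⟨s₁, rfl⟩ := relabel_inl_surjective t₁
    obtain ⟨s₂, rfl⟩ := relabel_inl_surjective t₂
    change (interp _ _ (Formula.eq s₁ s₂) ≠ _ ↔ Formula.eq s₁ s₂ ∈ Δ) ∧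
      (interp _ _ (Formula.eq s₁ s₂) ≠ _ ↔ neg (Formula.eq s₁ s₂) ∈ Δ)
    rw [interp_eq, Struc.eq_ne_ff, termVal_canonical, termVal_canonical]
    refine ⟨hΔ.cls_eq_cls, hΔ.ascribed_ne_tt.trans ⟨?_, ?_⟩⟩
    · exact hΔ.neg_eq_mem (hΔ.eq_symm_mem (hΔ.eq_rep_cls_mem _))
        (hΔ.eq_symm_mem (hΔ.eq_rep_cls_mem _))
    · exact hΔ.neg_eq_mem (hΔ.eq_rep_cls_mem _) (hΔ.eq_rep_cls_mem _)
  | neg A =>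
    obtain ⟨h, h'⟩ := ih _ (by simp [size]) A rfl
    rw [hΔ.neg_neg_mem, ← h, ← h']
    change ((interp _ _ A).neg ≠ _ ↔ _) ∧ ((interp _ _ A).neg ≠ _ ↔ _)
    simp
  | conj A B =>
    obtain ⟨hA, hA'⟩ := ih _ (by simp only [size]; omega) A rfl
    obtain ⟨hB, hB'⟩ := ih _ (by simp only [size]; omega) B rfl
    rw [hΔ.neg_conj_mem, hΔ.conj_mem, ← hA, ← hA', ← hB, ← hB']
    change ((interp _ _ A).conj (interp _ _ B) ≠ _ ↔ _) ∧
      ((interp _ _ A).conj (interp _ _ B) ≠ _ ↔ _)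
    simp only [ne_eq, TruthValue.conj_eq_ff, TruthValue.conj_eq_tt]
    exact ⟨not_or, not_and_or⟩
  | disj A B =>
    obtain ⟨hA, hA'⟩ := ih _ (by simp only [size]; omega) A rfl
    obtain ⟨hB, hB'⟩ := ih _ (by simp only [size]; omega) B rfl
    rw [hΔ.neg_disj_mem, hΔ.disj_mem, ← hA, ← hA', ← hB, ← hB']
    change ((interp _ _ A).disj (interp _ _ B) ≠ _ ↔ _) ∧
      ((interp _ _ A).disj (interp _ _ B) ≠ _ ↔ _)
    simp only [ne_eq, TruthValue.disj_eq_ff, TruthValue.disj_eq_tt]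
    exact ⟨not_and_or, not_or⟩
  | impl A B =>
    obtain ⟨hA, hA'⟩ := ih _ (by simp only [size]; omega) A rfl
    obtain ⟨hB, hB'⟩ := ih _ (by simp only [size]; omega) B rfl
    rw [hΔ.neg_impl_mem, hΔ.impl_mem, ← hA, ← hB, ← hB']
    change ((interp _ _ A).impl (interp _ _ B) ≠ _ ↔ _) ∧
      ((interp _ _ A).impl (interp _ _ B) ≠ _ ↔ _)
    simp only [ne_eq, TruthValue.impl_eq_ff, TruthValue.impl_eq_tt]
    exact ⟨not_and, not_or⟩
  | all B =>
    -- A nameless body is written with a named variable, so that the lemmas about `forall_ x A`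
    -- apply.
    obtain ⟨x, A, rfl⟩ := exists_eq_close B
    have ih' := fun t => ih (A.subst x t).size
      (by rw [size, size_subst, size_close]; exact Nat.lt_succ_self _) (A.subst x t) rfl
    rw [show all (A.close x) = forall_ x A from rfl, interp_forall, ne_eq, ne_eq,
      TruthValue.all_eq_ff, TruthValue.all_eq_tt,
      hΔ.exists_interp_update x A (· = TruthValue.ff),
      hΔ.forall_interp_update x A (· = TruthValue.tt), hΔ.forall_mem, hΔ.neg_forall_mem,
      not_exists, not_forall]
    exact ⟨forall_congr' fun t => (ih' t).1, exists_congr fun t => (ih' t).2⟩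
  | ex B =>
    obtain ⟨x, A, rfl⟩ := exists_eq_close B
    have ih' := fun t => ih (A.subst x t).size
      (by rw [size, size_subst, size_close]; exact Nat.lt_succ_self _) (A.subst x t) rfl
    rw [show ex (A.close x) = exists_ x A from rfl, interp_exists, ne_eq, ne_eq,
      TruthValue.ex_eq_ff, TruthValue.ex_eq_tt,
      hΔ.exists_interp_update x A (· = TruthValue.tt),
      hΔ.forall_interp_update x A (· = TruthValue.ff), hΔ.exists_mem, hΔ.neg_exists_mem,
      not_exists, not_forall]
    exact ⟨exists_congr fun t => (ih' t).1, forall_congr' fun t => (ih' t).2⟩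

end Saturated

end TermModel

/-! ### Completeness -/

theorem lcon_iff {Γ : Finset (Formula L)} {A : Formula L} :
    LCon.{u, v, w} Γ A ↔ ∀ (S : Struc.{u, v, w} L) (α : ℕ → S.U),
      (∀ B ∈ Γ, interp S α B ≠ TruthValue.ff) → interp S α A ≠ TruthValue.ff := by
  have key : ∀ a : TruthValue, (a = TruthValue.tt ∨ a = TruthValue.both) ↔ a ≠ TruthValue.ff := by
    intro a; cases a <;> simp
  refine forall_congr' fun S => forall_congr' fun α => ?_
  rw [key, or_iff_not_imp_left]
  simp only [not_exists, not_and, ne_eq]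

/-- Completeness of the proof system. -/
theorem derivable_of_lcon [∀ n, Countable (L.Functions n)] [∀ n, Countable (L.Relations n)]
    {Γ : Finset (Formula L)} {A : Formula L} (h : LCon.{u, v, max u w} Γ A) :
    Derivable ⟨Γ, A⟩ := by
  by_contra hd
  obtain ⟨Δ, hΓ, hΔ⟩ := exists_saturated hd
  refine hΔ.notMem ((hΔ.truth A).1.1 (lcon_iff.1 h (Saturated.termModel.{u, v, w} hΔ) _ ?_))
  exact fun B hB => (hΔ.truth B).1.2 (hΓ hB)

end LPif

theorem theorem1 (L : FirstOrder.Language.{0, 0})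
    [∀ n, Countable (L.Functions n)] [∀ n, Countable (L.Relations n)]
    (Γ : Finset (LPif.Formula L)) (A : LPif.Formula L) :
    LPif.Provable Γ A ↔ LPif.LCon.{0, 0, w} Γ A := by
  rw [LPif.provable_iff_derivable]
  exact ⟨fun h => LPif.lcon_iff.2 h.sound, LPif.derivable_of_lcon.{0, 0, w}⟩
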